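/- Let $\mathbb{S}^3\subset\mathbb{H}$ be the group of unit quaternions, where $\mathbb{H}=\mathbb{R}^4$ via $(x_0,x_1,x_2,x_3)=x_0+x_1\mathbf{i}+x_2\mathbf{j}+x_3\mathbf{k}$, and write tangent vectors of $\mathbb{S}^3\times\mathbb{S}^3$ at $(p,q)$ as $Z=(U,V)$ with $U\in T_p\mathbb{S}^3$, $V\in T_q\mathbb{S}^3$. Equip $\mathbb{S}^3\times\mathbb{S}^3$ with its homogeneous nearly Kähler structure $(g,J)$, i.e. the almost complex structure $$J(U,V)=\tfrac{1}{\sqrt3}\big(2pq^{-1}V-U,\,-2qp^{-1}U+V\big)$$ and the metric $g(Z,Z')=\tfrac12\big(\langle Z,Z'\rangle+\langle JZ,JZ'\rangle\big)$, where $\langle\cdot,\cdot\rangle$ is the standard product metric; let $\tilde\nabla$ be the Levi-Civita connection of $g$. An immersion of a $3$-manifold $M$ into $\mathbb{S}^3\times\mathbb{S}^3$ is Lagrangian if $J\,TM=T^\perp M$. Let $\nabla$, $\nabla^\perp$ and $h$ denote its induced connection, normal connection and second fundamental form, and put $(\nabla h)(X,Y,Z)=\nabla^\perp_X h(Y,Z)-h(\nabla_XY,Z)-h(Y,\nabla_XZ)$.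 A Lagrangian immersion is called $J$-isotropic if there is a function $\lambda$ on $M$ such that $$g\big((\nabla h)(v,v,v),Jv\big)=\lambda(x)\,g(v,v)^2\qquad\text{for all } x\in M,\ v\in T_xM,$$ and $J$-parallel if this holds with $\lambda=0$. It is totally geodesic if $h=0$. **Proposition 5.1.** Consider the maps $$f_7:\mathbb{S}^3\to\mathbb{S}^3\times\mathbb{S}^3,\quad u\mapsto(u\mathbf{i}u^{-1},\,u\mathbf{j}u^{-1}),$$ $$f_8:\mathbb{R}^3\to\mathbb{S}^3\times\mathbb{S}^3,\quad (u,v,w)\mapsto(p(u,w),\,q(u,v)),$$ where, with $a=\tfrac{\sqrt3u}{2}$, $b=\tfrac{\sqrt3v}{2}$, $c=\tfrac{\sqrt3w}{2}$, $$p(u,w)=\big(\cos a\cos c,\ \cos a\sin c,\ \sin a\cos c,\ \sin a\sin c\big),$$ $$q(u,v)=\tfrac1{\sqrt2}\big(\cos b(\sin a+\cos a),\ \sin b(\sin a+\cos a),\ \cos b(\sin a-\cos a),\ \sin b(\sin a-\cos a)\big).$$ Both $f_7$ and $f_8$ are Lagrangian immersions which are not totally geodesic, and both are $J$-isotropic with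 $\lambda=0$, i.e. $J$-parallel. -/

import Mathlib

open scoped Manifold ContDiff Quaternion

noncomputable section

namespace NKS3S3

/-! ### The homogeneous nearly Kähler structure on `S³ × S³`

`S³` is the unit sphere of the quaternions `ℍ`. Tangent vectors of `S³ × S³` are identified, as
usual, with vectors `Z = (U, V)` of `ℍ × ℍ` such that `U ⊥ p` and `V ⊥ q`. -/

/-- The ambient vector space `ℍ × ℍ` of `S³ × S³`. -/
abbrev Amb : Type := ℍ[ℝ] × ℍ[ℝ]

/-- The sphere of unit quaternions, with the smooth structure it has in Mathlib. -/
abbrev S3 : Type := Metric.sphere (0 : ℍ[ℝ]) 1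

instance factFinrankQuaternion : Fact (Module.finrank ℝ ℍ[ℝ] = 3 + 1) :=
  ⟨Quaternion.finrank_eq_four⟩

/-- `z` lies on `S³ × S³ ⊆ ℍ × ℍ`. -/
def OnN (z : Amb) : Prop := ‖z.1‖ = 1 ∧ ‖z.2‖ = 1

/-- `Z` is tangent to `S³ × S³` at `z`. -/
def IsTangent (z Z : Amb) : Prop := inner ℝ z.1 Z.1 = 0 ∧ inner ℝ z.2 Z.2 = 0

/-- The almost complex structure
`J (U, V) = (1/√3) (2 p q⁻¹ V - U, -2 q p⁻¹ U + V)` at `z = (p, q)`. -/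
def J (z Z : Amb) : Amb :=
  (Real.sqrt 3)⁻¹ • ((2 : ℝ) • (z.1 * z.2⁻¹ * Z.2) - Z.1, -((2 : ℝ) • (z.2 * z.1⁻¹ * Z.1)) + Z.2)

/-- The standard product metric. -/
def prodMetric (Z Z' : Amb) : ℝ := inner ℝ Z.1 Z'.1 + inner ℝ Z.2 Z'.2

/-- The Hermitian metric `g(Z, Z') = (⟨Z, Z'⟩ + ⟨J Z, J Z'⟩) / 2` at `z`. -/
def g (z Z Z' : Amb) : ℝ := (1 / 2) * (prodMetric Z Z' + prodMetric (J z Z) (J z Z'))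

/-- Projection of `ℍ × ℍ` onto the tangent space of `S³ × S³` at `z`, orthogonal with respect to
the standard metric. -/
def tanProj (z W : Amb) : Amb :=
  (W.1 - (inner ℝ z.1 W.1 : ℝ) • z.1, W.2 - (inner ℝ z.2 W.2 : ℝ) • z.2)

/-! ### The Levi-Civita connection of `g`

Every affine connection on `S³ × S³` is the sum of the connection `tanProj (dY (X))` induced by the
flat connection of `ℍ × ℍ` and of a tensor field `S` of type `(1, 2)`. -/

/-- A smooth vector field on `S³ × S³`, written as the restriction of a smooth
map `ℍ × ℍ → ℍ × ℍ`. -/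
def IsVectorField (X : Amb → Amb) : Prop :=
  ContDiff ℝ ∞ X ∧ ∀ z, OnN z → IsTangent z (X z)

/-- The covariant derivative `D_X Y` at `z` of the connection given by the tensor field `S`. -/
def connection (S : Amb → Amb → Amb → Amb) (X Y : Amb → Amb) (z : Amb) : Amb :=
  tanProj z (fderiv ℝ Y z (X z)) + S z (X z) (Y z)

/-- The connection given by the tensor field `S` is the Levi-Civita connection of `g`: `S` is
tangent-valued and bilinear on tangent vectors, the connection is torsion-free and it is metric. -/
structure IsLeviCivita (S : Amb → Amb → Amb → Amb) : Prop where
  tangent : ∀ z, OnN z → ∀ X Y, IsTangent z X → IsTangent z Y → IsTangent z (S z X Y)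
  linear_left : ∀ z, OnN z → ∀ (a : ℝ) (X X' Y : Amb), IsTangent z X → IsTangent z X' →
    IsTangent z Y → S z (a • X + X') Y = a • S z X Y + S z X' Y
  linear_right : ∀ z, OnN z → ∀ (a : ℝ) (X Y Y' : Amb), IsTangent z X → IsTangent z Y →
    IsTangent z Y' → S z X (a • Y + Y') = a • S z X Y + S z X Y'
  torsionFree : ∀ X Y, IsVectorField X → IsVectorField Y → ∀ z, OnN z →
    connection S X Y z - connection S Y X z = VectorField.lieBracket ℝ X Y z
  metric : ∀ X Y Z, IsVectorField X → IsVectorField Y → IsVectorField Z → ∀ z, OnN z →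
    fderiv ℝ (fun w => g w (Y w) (Z w)) z (X z) =
      g z (connection S X Y z) (Z z) + g z (Y z) (connection S X Z z)

/-- The difference between the Levi-Civita connection of `g` and the one induced by the flat
connection of `ℍ × ℍ`; see `isLeviCivita_lcTensor` and `IsLeviCivita.eq_lcTensor`. With
`α = p⁻¹ U`, `β = q⁻¹ V`, `α' = p⁻¹ U'`, `β' = q⁻¹ V'`, it maps `(U, V)`, `(U', V')` to
`(-p w / 3, q w / 3)` where `w = ([α, β'] + [α', β]) / 2`. -/
def lcTensor (z X Y : Amb) : Amb :=
  let α := z.1⁻¹ * X.1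
  let β := z.2⁻¹ * X.2
  let α' := z.1⁻¹ * Y.1
  let β' := z.2⁻¹ * Y.2
  let w := (1 / 2 : ℝ) • ((α * β' - β' * α) + (α' * β - β * α'))
  (-(1 / 3 : ℝ) • (z.1 * w), (1 / 3 : ℝ) • (z.2 * w))

theorem inv_eq_star {p : ℍ[ℝ]} (hp : ‖p‖ = 1) : p⁻¹ = star p := by
  rw [Quaternion.inv_def, Quaternion.normSq_eq_norm_mul_self, hp]; simp

theorem normSq_one {p : ℍ[ℝ]} (hp : ‖p‖ = 1) :
    p.re ^ 2 + p.imI ^ 2 + p.imJ ^ 2 + p.imK ^ 2 = 1 := by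
  have := Quaternion.normSq_eq_norm_mul_self p
  rw [hp, Quaternion.normSq_def'] at this; linarith

theorem inner_eq (a b : ℍ[ℝ]) :
    (inner ℝ a b : ℝ) = a.re * b.re + a.imI * b.imI + a.imJ * b.imJ + a.imK * b.imK := by
  rw [Quaternion.inner_def]; simp

/-- Left multiplication by a unit quaternion is isometric. -/
theorem inner_mul_left {p : ℍ[ℝ]} (hp : ‖p‖ = 1) (a b : ℍ[ℝ]) :
    (inner ℝ (p * a) (p * b) : ℝ) = inner ℝ a b := by
  have h := normSq_one hp
  simp only [inner_eq, Quaternion.re_mul, Quaternion.imI_mul, Quaternion.imJ_mul,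
    Quaternion.imK_mul]
  linear_combination (a.re * b.re + a.imI * b.imI + a.imJ * b.imJ + a.imK * b.imK) * h

/-- A tangent vector of `S³` at `p` is `p * α` with `α` purely imaginary. -/
theorem exists_eq_mul {p U : ℍ[ℝ]} (hp : ‖p‖ = 1) (hU : inner ℝ p U = 0) :
    ∃ α : ℍ[ℝ], α.re = 0 ∧ U = p * α := by
  have hp0 : p ≠ 0 := by rintro rfl; simp at hp
  refine ⟨p⁻¹ * U, ?_, by rw [← mul_assoc, mul_inv_cancel₀ hp0, one_mul]⟩
  rw [inv_eq_star hp]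
  rw [inner_eq] at hU
  simp; linarith

theorem inner_mul_im {p : ℍ[ℝ]} (hp : ‖p‖ = 1) {α : ℍ[ℝ]} (hα : α.re = 0) :
    inner ℝ p (p * α) = 0 := by
  have := inner_mul_left hp 1 α
  rw [mul_one] at this
  rw [this, inner_eq]; simp [hα]

/-- The metric as a polynomial. -/
def g' (z Z Z' : Amb) : ℝ :=
  (4 / 3) * (inner ℝ Z.1 Z'.1 + inner ℝ Z.2 Z'.2) -
    (2 / 3) * (inner ℝ (star z.1 * Z.1) (star z.2 * Z'.2) +
      inner ℝ (star z.1 * Z'.1) (star z.2 * Z.2))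

theorem norm_ne {p : ℍ[ℝ]} (hp : ‖p‖ = 1) : p ≠ 0 := by rintro rfl; simp at hp

theorem g_frame (p q a b c d : ℍ[ℝ]) (hp : ‖p‖ = 1) (hq : ‖q‖ = 1) :
    g (p, q) (p * a, q * b) (p * c, q * d) =
      (4 / 3) * (inner ℝ a c + inner ℝ b d) - (2 / 3) * (inner ℝ a d + inner ℝ c b) := by
  have h3 : (Real.sqrt 3)⁻¹ * (Real.sqrt 3)⁻¹ = (1 / 3 : ℝ) := by
    rw [← mul_inv, Real.mul_self_sqrt (by norm_num)]; norm_num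
  have e1 : ∀ b : ℍ[ℝ], p * q⁻¹ * (q * b) = p * b := fun b => by
    rw [mul_assoc, ← mul_assoc q⁻¹, inv_mul_cancel₀ (norm_ne hq), one_mul]
  have e2 : ∀ b : ℍ[ℝ], q * p⁻¹ * (p * b) = q * b := fun b => by
    rw [mul_assoc, ← mul_assoc p⁻¹, inv_mul_cancel₀ (norm_ne hp), one_mul]
  have e3 : ∀ a b : ℍ[ℝ], J (p, q) (p * a, q * b) =
      (Real.sqrt 3)⁻¹ • (p * ((2 : ℝ) • b - a), q * (b - (2 : ℝ) • a)) := fun a b => by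
    simp only [J, e1, e2]
    congr 2
    · rw [mul_sub, mul_smul_comm]
    · rw [mul_sub, mul_smul_comm]; abel
  have e4 : (inner ℝ ((2 : ℝ) • b - a) ((2 : ℝ) • d - c) : ℝ)
      = 4 * inner ℝ b d - 2 * inner ℝ b c - 2 * inner ℝ a d + inner ℝ a c := by
    simp only [inner_eq]; simp; ring
  have e5 : (inner ℝ (b - (2 : ℝ) • a) (d - (2 : ℝ) • c) : ℝ)
      = inner ℝ b d - 2 * inner ℝ b c - 2 * inner ℝ a d + 4 * inner ℝ a c := by
    simp only [inner_eq]; simp; ring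
  simp only [g, prodMetric, e3, Prod.smul_fst, Prod.smul_snd, real_inner_smul_left,
    real_inner_smul_right, inner_mul_left hp, inner_mul_left hq, e4, e5]
  rw [real_inner_comm b c]
  linear_combination (1 / 2 * (5 * inner ℝ a c + 5 * inner ℝ b d - 4 * inner ℝ b c
    - 4 * inner ℝ a d)) * h3

/-- The second expression for the metric. -/
theorem g_eq (z Z Z' : Amb) (hz : OnN z) : g z Z Z' = g' z Z Z' := by
  obtain ⟨p, q⟩ := z
  obtain ⟨hp, hq⟩ := hz
  dsimp only at hp hq
  have key : ∀ (p : ℍ[ℝ]), ‖p‖ = 1 → ∀ U, ∃ a, U = p * a ∧ star p * U = a := fun p hp U =>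
    ⟨p⁻¹ * U, by rw [← mul_assoc, mul_inv_cancel₀ (norm_ne hp), one_mul], by rw [inv_eq_star hp]⟩
  obtain ⟨a, ha, ha'⟩ := key p hp Z.1
  obtain ⟨b, hb, hb'⟩ := key q hq Z.2
  obtain ⟨c, hc, hc'⟩ := key p hp Z'.1
  obtain ⟨d, hd, hd'⟩ := key q hq Z'.2
  have hZ : Z = (p * a, q * b) := Prod.ext ha hb
  have hZ' : Z' = (p * c, q * d) := Prod.ext hc hd
  rw [g', ha', hb', hc', hd', hZ, hZ', g_frame p q a b c d hp hq]
  simp only [inner_mul_left hp, inner_mul_left hq]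

/-- A function vanishing on `S³ × S³` has vanishing derivative in tangent directions. -/
theorem fderiv_eq_zero (φ : Amb → ℝ) (z X : Amb) (hz : OnN z) (hX : IsTangent z X)
    (hφ : DifferentiableAt ℝ φ z) (h0 : ∀ w, OnN w → φ w = 0) : fderiv ℝ φ z X = 0 := by
  have key : ∀ p U : ℍ[ℝ], ‖p‖ = 1 → inner ℝ p U = 0 → ∃ c : ℝ → ℍ[ℝ],
      c 0 = p ∧ (∀ t, ‖c t‖ = 1) ∧ HasDerivAt c U 0 := by
    intro p U hp hU
    refine ⟨fun t => (Real.sqrt (1 + t ^ 2 * ‖U‖ ^ 2))⁻¹ • (p + t • U), by simp, ?_, ?_⟩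
    · intro t
      have hpos : 0 < 1 + t ^ 2 * ‖U‖ ^ 2 := by positivity
      have : ‖p + t • U‖ = Real.sqrt (1 + t ^ 2 * ‖U‖ ^ 2) := by
        have e : 1 + t ^ 2 * ‖U‖ ^ 2 = ‖p + t • U‖ ^ 2 := by
          rw [norm_add_sq_real, real_inner_smul_right, hU, hp, norm_smul, mul_pow,
            Real.norm_eq_abs, sq_abs]; ring
        rw [e, Real.sqrt_sq (norm_nonneg _)]
      rw [norm_smul, this, Real.norm_eq_abs, abs_of_pos (by positivity),
        inv_mul_cancel₀ (by positivity)]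
    · have h1 : HasDerivAt (fun t : ℝ => 1 + t ^ 2 * ‖U‖ ^ 2) 0 0 := by
        have := ((hasDerivAt_pow 2 (0 : ℝ)).mul_const (‖U‖ ^ 2)).const_add 1
        simpa using this
      have h2 : HasDerivAt (fun t : ℝ => (Real.sqrt (1 + t ^ 2 * ‖U‖ ^ 2))⁻¹) 0 0 := by
        have := (h1.sqrt (by simp)).inv (by simp)
        rw [zero_div, neg_zero, zero_div] at this
        exact this
      have h3 : HasDerivAt (fun t : ℝ => p + t • U) U 0 := by
        simpa using ((hasDerivAt_id (0 : ℝ)).smul_const U).const_add p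
      have := h2.smul h3
      have e : (Real.sqrt (1 + (0 : ℝ) ^ 2 * ‖U‖ ^ 2))⁻¹ • U + (0 : ℝ) • (p + (0 : ℝ) • U) = U := by
        simp
      rw [e] at this
      exact this
  obtain ⟨c, hc0, hc1, hc2⟩ := key z.1 X.1 hz.1 hX.1
  obtain ⟨d, hd0, hd1, hd2⟩ := key z.2 X.2 hz.2 hX.2
  have hcd : HasDerivAt (fun t => (c t, d t)) X 0 := hc2.prodMk hd2
  have hz' : (c 0, d 0) = z := by rw [hc0, hd0]
  have h := (hz' ▸ hφ.hasFDerivAt : HasFDerivAt φ (fderiv ℝ φ z) (c 0, d 0)).comp_hasDerivAt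
    (0 : ℝ) hcd
  have h' : (φ ∘ fun t => (c t, d t)) = fun _ => 0 := by
    funext t; exact h0 _ ⟨hc1 t, hd1 t⟩
  rw [h'] at h
  exact h.unique (hasDerivAt_const _ _)

theorem isTangent_frame {z X : Amb} (hz : OnN z) (hX : IsTangent z X) :
    ∃ a b : ℍ[ℝ], a.re = 0 ∧ b.re = 0 ∧ X = (z.1 * a, z.2 * b) := by
  obtain ⟨a, ha, ha'⟩ := exists_eq_mul hz.1 hX.1
  obtain ⟨b, hb, hb'⟩ := exists_eq_mul hz.2 hX.2
  exact ⟨a, b, ha, hb, Prod.ext ha' hb'⟩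

theorem lcTensor_frame {z : Amb} (hz : OnN z) (a b c d : ℍ[ℝ]) :
    lcTensor z (z.1 * a, z.2 * b) (z.1 * c, z.2 * d) =
      (z.1 * (-(1 / 6 : ℝ) • ((a * d - d * a) + (c * b - b * c))),
        z.2 * ((1 / 6 : ℝ) • ((a * d - d * a) + (c * b - b * c)))) := by
  have e : ∀ p : ℍ[ℝ], ‖p‖ = 1 → ∀ a, p⁻¹ * (p * a) = a := fun p hp a => by
    rw [← mul_assoc, inv_mul_cancel₀ (norm_ne hp), one_mul]
  simp only [lcTensor, e _ hz.1, e _ hz.2]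
  simp only [mul_smul_comm, smul_smul]
  norm_num

theorem tangent_deriv {Y : Amb → Amb} (hY : IsVectorField Y) {z X : Amb} (hz : OnN z)
    (hX : IsTangent z X) :
    inner ℝ z.1 (fderiv ℝ Y z X).1 = -(inner ℝ X.1 (Y z).1 : ℝ) ∧
      inner ℝ z.2 (fderiv ℝ Y z X).2 = -(inner ℝ X.2 (Y z).2 : ℝ) := by
  have hd : HasFDerivAt Y (fderiv ℝ Y z) z :=
    (hY.1.differentiable (by simp) z).hasFDerivAt
  have h1 := (hasFDerivAt_fst (𝕜 := ℝ) (p := z)).inner ℝ hd.fst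
  have h2 := (hasFDerivAt_snd (𝕜 := ℝ) (p := z)).inner ℝ hd.snd
  have k1 := fderiv_eq_zero _ z X hz hX h1.differentiableAt fun w hw => (hY.2 w hw).1
  have k2 := fderiv_eq_zero _ z X hz hX h2.differentiableAt fun w hw => (hY.2 w hw).2
  rw [h1.fderiv] at k1
  rw [h2.fderiv] at k2
  simp at k1 k2
  constructor <;> linarith

/-- Quaternionic conjugation as a continuous linear map. -/
def starCLM : ℍ[ℝ] →L[ℝ] ℍ[ℝ] :=
  LinearMap.toContinuousLinearMap
    { toFun := fun a => star a
      map_add' := fun a b => star_add a b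
      map_smul' := fun r a => by ext <;> simp }

theorem isLeviCivita_lcTensor : IsLeviCivita lcTensor where
  tangent z hz X Y hX hY := by
    obtain ⟨a, b, ha, hb, rfl⟩ := isTangent_frame hz hX
    obtain ⟨c, d, hc, hd, rfl⟩ := isTangent_frame hz hY
    rw [lcTensor_frame hz]
    refine ⟨inner_mul_im hz.1 ?_, inner_mul_im hz.2 ?_⟩ <;> simp <;> ring
  linear_left z hz r X X' Y hX hX' hY := by
    simp only [lcTensor, Prod.fst_add, Prod.snd_add, Prod.smul_fst, Prod.smul_snd, mul_add, add_mul,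
      mul_smul_comm, smul_mul_assoc]
    ext1 <;> simp only [Prod.fst_add, Prod.snd_add, Prod.smul_fst, Prod.smul_snd, mul_add, mul_sub,
      mul_smul_comm] <;> module
  linear_right z hz r X Y Y' hX hY hY' := by
    simp only [lcTensor, Prod.fst_add, Prod.snd_add, Prod.smul_fst, Prod.smul_snd, mul_add, add_mul,
      mul_smul_comm, smul_mul_assoc]
    ext1 <;> simp only [Prod.fst_add, Prod.snd_add, Prod.smul_fst, Prod.smul_snd, mul_add, mul_sub,
      mul_smul_comm] <;> module
  torsionFree X Y hX hY z hz := by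
    obtain ⟨h1, h2⟩ := tangent_deriv hY hz (hX.2 z hz)
    obtain ⟨h3, h4⟩ := tangent_deriv hX hz (hY.2 z hz)
    have hs : lcTensor z (X z) (Y z) = lcTensor z (Y z) (X z) := by
      simp only [lcTensor]
      ext1 <;> simp only [mul_add, mul_sub, mul_smul_comm] <;> module
    rw [connection, connection, hs, VectorField.lieBracket, tanProj, tanProj, h1, h2, h3, h4,
      real_inner_comm (Y z).1, real_inner_comm (Y z).2]
    ext1 <;> simp
  metric X Y Z hX hY hZ z hz := by
    have dX := hX.2 z hz
    have hY' : HasFDerivAt Y (fderiv ℝ Y z) z := (hY.1.differentiable (by simp) z).hasFDerivAt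
    have hZ' : HasFDerivAt Z (fderiv ℝ Z z) z := (hZ.1.differentiable (by simp) z).hasFDerivAt
    have hg : DifferentiableAt ℝ (fun w => g w (Y w) (Z w)) z := by
      have hJ : ∀ V : Amb → Amb, DifferentiableAt ℝ V z →
          DifferentiableAt ℝ (fun w => J w (V w)) z := by
        intro V hV
        have i1 : DifferentiableAt ℝ (fun w : Amb => w.1⁻¹) z :=
          DifferentiableAt.inv (h := fun w : Amb => w.1) differentiableAt_fst (norm_ne hz.1)
        have i2 : DifferentiableAt ℝ (fun w : Amb => w.2⁻¹) z :=
          DifferentiableAt.inv (h := fun w : Amb => w.2) differentiableAt_snd (norm_ne hz.2)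
        have k := ((((differentiableAt_fst.mul i2).mul hV.snd).const_smul (2 : ℝ)).sub hV.fst).prodMk
          ((((differentiableAt_snd.mul i1).mul hV.fst).const_smul (2 : ℝ)).neg.add hV.snd)
          |>.const_smul (Real.sqrt 3)⁻¹
        exact k
      have y := hY'.differentiableAt
      have y' := hJ Y y
      have v := hZ'.differentiableAt
      have v' := hJ Z v
      exact (((y.fst.inner ℝ v.fst).add (y.snd.inner ℝ v.snd)).add
        ((y'.fst.inner ℝ v'.fst).add (y'.snd.inner ℝ v'.snd))).const_mul _
    have hs1 : HasFDerivAt (fun w : Amb => star w.1) _ z :=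
      starCLM.hasFDerivAt.comp z hasFDerivAt_fst
    have hs2 : HasFDerivAt (fun w : Amb => star w.2) _ z :=
      starCLM.hasFDerivAt.comp z hasFDerivAt_snd
    have hg' := (((hY'.fst.inner ℝ hZ'.fst).add (hY'.snd.inner ℝ hZ'.snd)).const_mul (4 / 3)).sub
      ((((hs1.mul' hY'.fst).inner ℝ (hs2.mul' hZ'.snd)).add
        ((hs1.mul' hZ'.fst).inner ℝ (hs2.mul' hY'.snd))).const_mul (2 / 3))
    have h0 := fderiv_eq_zero (fun w => g w (Y w) (Z w) - g' w (Y w) (Z w)) z (X z) hz dX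
      (hg.sub hg'.differentiableAt) (fun w hw => by rw [g_eq _ _ _ hw, sub_self])
    rw [HasFDerivAt.fderiv (f := fun w => g w (Y w) (Z w) - g' w (Y w) (Z w))
      (hg.hasFDerivAt.sub hg')] at h0
    obtain ⟨α, β, hα, hβ, hX'⟩ := isTangent_frame hz dX
    obtain ⟨a, b, ha, hb, hYf⟩ := isTangent_frame hz (hY.2 z hz)
    obtain ⟨c, d, hc, hd, hZf⟩ := isTangent_frame hz (hZ.2 z hz)
    have key : ∀ W : Amb, ∃ a b : ℍ[ℝ], W = (z.1 * a, z.2 * b) := fun W =>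
      ⟨z.1⁻¹ * W.1, z.2⁻¹ * W.2, Prod.ext
        (by dsimp only; rw [← mul_assoc, mul_inv_cancel₀ (norm_ne hz.1), one_mul])
        (by dsimp only; rw [← mul_assoc, mul_inv_cancel₀ (norm_ne hz.2), one_mul])⟩
    obtain ⟨a', b', hY''⟩ := key (fderiv ℝ Y z (X z))
    obtain ⟨c', d', hZ''⟩ := key (fderiv ℝ Z z (X z))
    have es : ∀ p : ℍ[ℝ], ‖p‖ = 1 → ∀ x y, star (p * x) * (p * y) = star x * y := fun p hp x y => by
      rw [star_mul, mul_assoc, ← mul_assoc (star p), ← inv_eq_star hp,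
        inv_mul_cancel₀ (norm_ne hp), one_mul]
    have es' : ∀ p : ℍ[ℝ], ‖p‖ = 1 → ∀ y, star p * (p * y) = y := fun p hp y => by
      simpa using es p hp 1 y
    have ei : ∀ p : ℍ[ℝ], ‖p‖ = 1 → ∀ y, inner ℝ p (p * y) = y.re := fun p hp y => by
      have := inner_mul_left hp 1 y
      rw [mul_one] at this
      rw [this, inner_eq]; simp
    simp only [sub_apply, add_apply, smul_apply, ContinuousLinearMap.comp_apply,
      ContinuousLinearMap.prod_apply, ContinuousLinearMap.coe_fst', ContinuousLinearMap.coe_snd',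
      fderivInnerCLM_apply, Pi.mul_apply, MulOpposite.smul_eq_mul_unop, MulOpposite.unop_op,
      smul_eq_mul, show ∀ x, starCLM x = star x from fun _ => rfl] at h0
    rw [hY'', hZ''] at h0
    simp only [hX', hYf, hZf, es _ hz.1, es _ hz.2, es' _ hz.1, es' _ hz.2, inner_mul_left hz.1, inner_mul_left hz.2] at h0
    rw [sub_eq_zero, ← hX'] at h0
    rw [h0]
    have ec : ∀ (V : Amb → Amb) (a b a' b' : ℍ[ℝ]), V z = (z.1 * a, z.2 * b) →
        fderiv ℝ V z (X z) = (z.1 * a', z.2 * b') → connection lcTensor X V z =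
        (z.1 * (a' - (a'.re : ℝ) • 1 + -(1 / 6 : ℝ) • ((α * b - b * α) + (a * β - β * a))),
         z.2 * (b' - (b'.re : ℝ) • 1 + (1 / 6 : ℝ) • ((α * b - b * α) + (a * β - β * a)))) := by
      intro V a b a' b' h1 h2
      rw [connection, h1, h2, hX', lcTensor_frame hz, tanProj, ei _ hz.1, ei _ hz.2]
      ext1 <;> simp only [Prod.fst_add, Prod.snd_add, mul_add, mul_sub, mul_smul_comm, mul_one]
    rw [ec Y a b a' b' hYf hY'', ec Z c d c' d' hZf hZ'', hYf, hZf]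
    rw [show z = (z.1, z.2) from rfl, g_frame _ _ _ _ _ _ hz.1 hz.2, g_frame _ _ _ _ _ _ hz.1 hz.2]
    simp only [inner_eq]
    simp [hα, hβ, ha, hb, hc, hd]
    ring

/-- The Levi-Civita connection of `g` is unique. -/
theorem IsLeviCivita.eq_lcTensor {S : Amb → Amb → Amb → Amb} (hS : IsLeviCivita S) {z X Y : Amb}
    (hz : OnN z) (hX : IsTangent z X) (hY : IsTangent z Y) : S z X Y = lcTensor z X Y := by
  have ext : ∀ X, IsTangent z X → ∃ V, IsVectorField V ∧ V z = X := fun X hX => by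
    obtain ⟨a, b, ha, hb, rfl⟩ := isTangent_frame hz hX
    refine ⟨fun w => (w.1 * a, w.2 * b), ⟨?_, fun w hw => ?_⟩, rfl⟩
    · exact (contDiff_fst.mul contDiff_const).prodMk (contDiff_snd.mul contDiff_const)
    · exact ⟨inner_mul_im hw.1 ha, inner_mul_im hw.2 hb⟩
  have add : ∀ A B C, g z (A + B) C = g z A C + g z B C := fun A B C => by
    simp only [g_eq _ _ _ hz, g', Prod.fst_add, Prod.snd_add, mul_add, inner_add_left,
      inner_add_right]
    ring
  have symm : ∀ A B, g z A B = g z B A := fun A B => by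
    simp only [g_eq _ _ _ hz, g', real_inner_comm A.1, real_inner_comm A.2]
    ring
  have sym : ∀ X Y, IsTangent z X → IsTangent z Y →
      S z X Y - lcTensor z X Y = S z Y X - lcTensor z Y X := fun X Y hX hY => by
    obtain ⟨V, hV, rfl⟩ := ext X hX
    obtain ⟨W, hW, rfl⟩ := ext Y hY
    have h1 := hS.torsionFree V W hV hW z hz
    rw [← isLeviCivita_lcTensor.torsionFree V W hV hW z hz] at h1
    simp only [connection] at h1
    rw [sub_eq_sub_iff_add_eq_add] at h1 ⊢
    apply add_left_cancel
      (a := tanProj z (fderiv ℝ W z (V z)) + tanProj z (fderiv ℝ V z (W z)))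
    convert h1 using 1 <;> abel
  have anti : ∀ X Y Z, IsTangent z X → IsTangent z Y → IsTangent z Z →
      g z (S z X Y - lcTensor z X Y) Z = -g z (S z X Z - lcTensor z X Z) Y :=
    fun X Y Z hX hY hZ => by
    obtain ⟨U, hU, rfl⟩ := ext X hX
    obtain ⟨V, hV, rfl⟩ := ext Y hY
    obtain ⟨W, hW, rfl⟩ := ext Z hZ
    have h1 := hS.metric U V W hU hV hW z hz
    rw [isLeviCivita_lcTensor.metric U V W hU hV hW z hz] at h1
    simp only [connection, add, symm (V z)] at h1
    have sub : ∀ A B C, g z (A - B) C = g z A C - g z B C := fun A B C => by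
      have := add (A - B) B C
      rw [sub_add_cancel] at this
      linarith
    rw [sub, sub]
    linarith
  have zero : ∀ X Y Z, IsTangent z X → IsTangent z Y → IsTangent z Z →
      g z (S z X Y - lcTensor z X Y) Z = 0 := fun X Y Z hX hY hZ => by
    have h1 := anti X Y Z hX hY hZ
    have h2 := anti Z X Y hZ hX hY
    have h3 := anti Y Z X hY hZ hX
    rw [sym X Z hX hZ] at h1
    rw [sym Z Y hZ hY] at h2
    rw [sym Y X hY hX] at h3
    linarith
  have htan : IsTangent z (S z X Y - lcTensor z X Y) := by
    have h1 := hS.tangent z hz X Y hX hY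
    have h2 := isLeviCivita_lcTensor.tangent z hz X Y hX hY
    exact ⟨by rw [Prod.fst_sub, inner_sub_right, h1.1, h2.1, sub_zero],
      by rw [Prod.snd_sub, inner_sub_right, h1.2, h2.2, sub_zero]⟩
  have h := zero X Y _ hX hY htan
  obtain ⟨a, b, -, -, e⟩ := isTangent_frame hz htan
  rw [e, show z = (z.1, z.2) from rfl, g_frame _ _ _ _ _ _ hz.1 hz.2] at h
  have h4 := real_inner_self_eq_norm_sq a
  have h5 := real_inner_self_eq_norm_sq b
  have h6 := real_inner_le_norm a b
  have h7 : ‖a‖ = 0 ∧ ‖b‖ = 0 := by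
    constructor <;> nlinarith [sq_nonneg (‖a‖ - ‖b‖), sq_nonneg ‖a‖, sq_nonneg ‖b‖]
  rw [norm_eq_zero.1 h7.1, norm_eq_zero.1 h7.2, mul_zero, mul_zero] at e
  exact sub_eq_zero.1 e

/-! ### Lagrangian immersions `f : M → S³ × S³`

`M` is a `3`-dimensional manifold. The position vector of `f`, the vector fields along `f` and the
images of tangent vectors of `M` are written in `ℍ × ℍ`. -/

section Immersions

variable {M : Type*} [TopologicalSpace M] [ChartedSpace (EuclideanSpace ℝ (Fin 3)) M]

/-- The map `f`, seen as a map to `ℍ × ℍ`. -/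
def pos (f : M → S3 × S3) (x : M) : Amb := ((f x).1, (f x).2)

/-- The differential of `f` at `x`, applied to a tangent vector `v` of `M`. -/
def df (f : M → S3 × S3) (x : M) (v : TangentSpace (𝓡 3) x) : Amb :=
  mfderiv (𝓡 3) 𝓘(ℝ, Amb) (pos f) x v

/-- The covariant derivative `∇̃_v V` of a vector field `V` along `f` with respect to the
Levi-Civita connection `∇̃` of `g`. -/
def ambCov (f : M → S3 × S3) (V : M → Amb) (x : M) (v : TangentSpace (𝓡 3) x) : Amb :=
  tanProj (pos f x) (mfderiv (𝓡 3) 𝓘(ℝ, Amb) V x v) + lcTensor (pos f x) (df f x v) (V x)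

/-- The tangential part, as a tangent vector of `M`, of the vector `W` at `f x`: the tangent vector
`ξ` such that `W - df ξ` is `g`-orthogonal to the image of the differential of `f`. -/
def tangentialPart (f : M → S3 × S3) (x : M) (W : Amb) : TangentSpace (𝓡 3) x :=
  Classical.epsilon fun ξ => ∀ η : TangentSpace (𝓡 3) x,
    g (pos f x) (W - df f x ξ) (df f x η) = 0

/-- The normal part of the vector `W` at `f x`. -/
def normalPart (f : M → S3 × S3) (x : M) (W : Amb) : Amb :=
  W - df f x (tangentialPart f x W)

/-- The induced connection: `∇_v Y` is the tangential part of `∇̃_v Y`. -/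
def indCov (f : M → S3 × S3) (Y : ∀ x : M, TangentSpace (𝓡 3) x) (x : M)
    (v : TangentSpace (𝓡 3) x) : TangentSpace (𝓡 3) x :=
  tangentialPart f x (ambCov f (fun y => df f y (Y y)) x v)

/-- The second fundamental form: `h(X, Y)` is the normal part of `∇̃_X Y`. -/
def secondFF (f : M → S3 × S3) (X Y : ∀ x : M, TangentSpace (𝓡 3) x) (x : M) : Amb :=
  normalPart f x (ambCov f (fun y => df f y (Y y)) x (X x))

/-- The normal connection: `∇^⊥_v N` is the normal part of `∇̃_v N`. -/
def normalCov (f : M → S3 × S3) (N : M → Amb) (x : M) (v : TangentSpace (𝓡 3) x) : Amb :=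
  normalPart f x (ambCov f N x v)

/-- The covariant derivative of the second fundamental form,
`(∇h)(X, Y, Z) = ∇^⊥_X h(Y, Z) - h(∇_X Y, Z) - h(Y, ∇_X Z)`. -/
def covSecondFF (f : M → S3 × S3) (X Y Z : ∀ x : M, TangentSpace (𝓡 3) x) (x : M) : Amb :=
  normalCov f (secondFF f Y Z) x (X x)
    - secondFF f (fun y => indCov f Y y (X y)) Z x
    - secondFF f Y (fun y => indCov f Z y (X y)) x

/-- Smooth vector fields on `M`. -/
def IsSmoothField [IsManifold (𝓡 3) ∞ M] (X : ∀ x : M, TangentSpace (𝓡 3) x) : Prop :=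
  ContMDiff (𝓡 3) (𝓡 3).tangent ∞ fun x => (⟨x, X x⟩ : TangentBundle (𝓡 3) M)

/-- `f` is a Lagrangian immersion: a smooth map with injective differential such that, at every
point, `J` maps the tangent space of `M` onto its `g`-orthogonal complement. -/
structure IsLagrangianImmersion (f : M → S3 × S3) : Prop where
  smooth : ContMDiff (𝓡 3) ((𝓡 3).prod (𝓡 3)) ∞ f
  immersion : ∀ x, Function.Injective (mfderiv (𝓡 3) ((𝓡 3).prod (𝓡 3)) f x)
  lagrangian : ∀ x, {Z | ∃ v, Z = J (pos f x) (df f x v)} =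
    {Z | IsTangent (pos f x) Z ∧ ∀ v, g (pos f x) Z (df f x v) = 0}

/-- `f` is totally geodesic: its second fundamental form vanishes. -/
def IsTotallyGeodesic [IsManifold (𝓡 3) ∞ M] (f : M → S3 × S3) : Prop :=
  ∀ X Y : ∀ x : M, TangentSpace (𝓡 3) x, IsSmoothField X → IsSmoothField Y →
    ∀ x, secondFF f X Y x = 0

/-- `f` is a `J`-isotropic Lagrangian immersion with isotropy function `lam`:
`g((∇h)(v, v, v), J v) = lam g(v, v)²` for all tangent vectors `v`. As `(∇h)(v, v, v)` is computed
by extending `v` to a vector field, this is required of all smooth vector fields. -/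
structure IsJIsotropicWith [IsManifold (𝓡 3) ∞ M] (f : M → S3 × S3) (lam : M → ℝ) : Prop
    extends IsLagrangianImmersion f where
  isotropic : ∀ X : ∀ x : M, TangentSpace (𝓡 3) x, IsSmoothField X → ∀ x,
    g (pos f x) (covSecondFF f X X X x) (J (pos f x) (df f x (X x))) =
      lam x * (g (pos f x) (df f x (X x)) (df f x (X x))) ^ 2

/-- `f` is `J`-parallel: it is `J`-isotropic with vanishing isotropy function. -/
def IsJParallel [IsManifold (𝓡 3) ∞ M] (f : M → S3 × S3) : Prop := IsJIsotropicWith f fun _ => 0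

end Immersions

/-! ### The two immersions -/

/-- The quaternion `i`. -/
def qi : ℍ[ℝ] := ⟨0, 1, 0, 0⟩

/-- The quaternion `j`. -/
def qj : ℍ[ℝ] := ⟨0, 0, 1, 0⟩

theorem mem_S3 {a : ℍ[ℝ]} (h : a.re ^ 2 + a.imI ^ 2 + a.imJ ^ 2 + a.imK ^ 2 = 1) :
    a ∈ Metric.sphere (0 : ℍ[ℝ]) 1 := by
  rw [mem_sphere_zero_iff_norm]
  have := Quaternion.normSq_eq_norm_mul_self a
  rw [Quaternion.normSq_def', h] at this
  nlinarith [norm_nonneg a]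

theorem conj_mem_S3 (u : S3) {a : ℍ[ℝ]} (ha : a ∈ Metric.sphere (0 : ℍ[ℝ]) 1) :
    (u : ℍ[ℝ]) * a * (u : ℍ[ℝ])⁻¹ ∈ Metric.sphere (0 : ℍ[ℝ]) 1 := by
  have hu : ‖(u : ℍ[ℝ])‖ = 1 := by simp
  rw [mem_sphere_zero_iff_norm] at *
  rw [norm_mul, norm_mul, norm_inv, hu, ha]; norm_num

/-- `f₇ : S³ → S³ × S³`, `u ↦ (u i u⁻¹, u j u⁻¹)`. -/
def f7 (u : S3) : S3 × S3 :=
  (⟨(u : ℍ[ℝ]) * qi * (u : ℍ[ℝ])⁻¹, conj_mem_S3 u (mem_S3 (by simp [qi]))⟩,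
    ⟨(u : ℍ[ℝ]) * qj * (u : ℍ[ℝ])⁻¹, conj_mem_S3 u (mem_S3 (by simp [qj]))⟩)

open Real in
/-- The torus `p` in `S³`; `(x₀, x₁, x₂, x₃)` stands for `x₀ + x₁ i + x₂ j + x₃ k`. -/
def torusP (u w : ℝ) : ℍ[ℝ] :=
  ⟨cos (√3 * u / 2) * cos (√3 * w / 2), cos (√3 * u / 2) * sin (√3 * w / 2),
    sin (√3 * u / 2) * cos (√3 * w / 2), sin (√3 * u / 2) * sin (√3 * w / 2)⟩

open Real in
/-- The torus `q` in `S³`. -/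
def torusQ (u v : ℝ) : ℍ[ℝ] :=
  ⟨1 / √2 * (cos (√3 * v / 2) * (sin (√3 * u / 2) + cos (√3 * u / 2))),
    1 / √2 * (sin (√3 * v / 2) * (sin (√3 * u / 2) + cos (√3 * u / 2))),
    1 / √2 * (cos (√3 * v / 2) * (sin (√3 * u / 2) - cos (√3 * u / 2))),
    1 / √2 * (sin (√3 * v / 2) * (sin (√3 * u / 2) - cos (√3 * u / 2)))⟩

theorem torusP_mem (u w : ℝ) : torusP u w ∈ Metric.sphere (0 : ℍ[ℝ]) 1 := by
  apply mem_S3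
  have h1 := Real.sin_sq_add_cos_sq (√3 * u / 2)
  have h2 := Real.sin_sq_add_cos_sq (√3 * w / 2)
  simp only [torusP]
  linear_combination (Real.sin (√3 * w / 2) ^ 2 + Real.cos (√3 * w / 2) ^ 2) * h1 + h2

theorem torusQ_mem (u v : ℝ) : torusQ u v ∈ Metric.sphere (0 : ℍ[ℝ]) 1 := by
  apply mem_S3
  have h1 := Real.sin_sq_add_cos_sq (√3 * u / 2)
  have h2 := Real.sin_sq_add_cos_sq (√3 * v / 2)
  have h3 : (1 / √2) ^ 2 = (1 / 2 : ℝ) := by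
    rw [div_pow, Real.sq_sqrt (by norm_num)]; norm_num
  simp only [torusQ, mul_pow, h3]
  linear_combination (Real.sin (√3 * v / 2) ^ 2 + Real.cos (√3 * v / 2) ^ 2) * h1 + h2

/-- `f₈ : ℝ³ → S³ × S³`, `(u, v, w) ↦ (p(u, w), q(u, v))`. -/
def f8 (x : EuclideanSpace ℝ (Fin 3)) : S3 × S3 :=
  (⟨torusP (x 0) (x 2), torusP_mem _ _⟩, ⟨torusQ (x 0) (x 1), torusQ_mem _ _⟩)

end NKS3S3

end

noncomputable section

namespace NKS3S3

/-! ### Quaternionic frames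

For unit quaternions `p`, `q`, `s` the map `(α, β) ↦ (p s α s⁻¹, q s β s⁻¹)` identifies pairs of
imaginary quaternions with tangent vectors of `S³ × S³` at `(p, q)`. -/

/-- The vector `(p s α s⁻¹, q s β s⁻¹)` at `z = (p, q)` attached to `A = (α, β)`. -/
def frameVec (z : Amb) (s : ℍ[ℝ]) (A : Amb) : Amb :=
  (z.1 * (s * A.1 * star s), z.2 * (s * A.2 * star s))

/-- Both components are purely imaginary. -/
def IsImag (A : Amb) : Prop := A.1.re = 0 ∧ A.2.re = 0

/-- The metric `g` in a quaternionic frame. -/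
def frameMetric (A B : Amb) : ℝ :=
  (4 / 3) * (inner ℝ A.1 B.1 + inner ℝ A.2 B.2) - (2 / 3) * (inner ℝ A.1 B.2 + inner ℝ B.1 A.2)

/-- The tensor `√3 J` in a quaternionic frame. -/
def frameJ : Amb →ₗ[ℝ] Amb where
  toFun A := ((2 : ℝ) • A.2 - A.1, A.2 - (2 : ℝ) • A.1)
  map_add' A B := by ext1 <;> simp <;> abel
  map_smul' r A := by
    ext1 <;> simp only [Prod.smul_fst, Prod.smul_snd, RingHom.id_apply] <;> module

/-- The covariant derivative of the frame vector of the constant pair `A`, in a direction in which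
`z` moves with velocity `frameVec z s N` and `s` with velocity `s σ`. -/
def frameCov (N : Amb) (σ : ℍ[ℝ]) (A : Amb) : Amb :=
  ((1 / 2 : ℝ) • (N.1 * A.1 - A.1 * N.1) + (σ * A.1 - A.1 * σ)
      - (1 / 6 : ℝ) • ((N.1 * A.2 - A.2 * N.1) + (A.1 * N.2 - N.2 * A.1)),
    (1 / 2 : ℝ) • (N.2 * A.2 - A.2 * N.2) + (σ * A.2 - A.2 * σ)
      + (1 / 6 : ℝ) • ((N.1 * A.2 - A.2 * N.1) + (A.1 * N.2 - N.2 * A.1)))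

theorem star_mul_self_eq_one {s : ℍ[ℝ]} (hs : ‖s‖ = 1) : star s * s = 1 := by
  rw [← inv_eq_star hs, inv_mul_cancel₀ (norm_ne hs)]

theorem mul_star_self_eq_one {s : ℍ[ℝ]} (hs : ‖s‖ = 1) : s * star s = 1 := by
  rw [← inv_eq_star hs, mul_inv_cancel₀ (norm_ne hs)]

theorem conj_mul_conj {s : ℍ[ℝ]} (hs : ‖s‖ = 1) (a b : ℍ[ℝ]) :
    s * a * star s * (s * b * star s) = s * (a * b) * star s := by
  calc _ = s * a * (star s * s) * b * star s := by simp only [mul_assoc]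
    _ = _ := by rw [star_mul_self_eq_one hs]; simp only [mul_assoc, mul_one]

theorem re_conj {s : ℍ[ℝ]} (hs : ‖s‖ = 1) (a : ℍ[ℝ]) : (s * a * star s).re = a.re := by
  have h := normSq_one hs
  simp only [Quaternion.re_mul, Quaternion.imI_mul, Quaternion.imJ_mul, Quaternion.imK_mul,
    Quaternion.re_star, Quaternion.imI_star, Quaternion.imJ_star, Quaternion.imK_star]
  linear_combination a.re * h

theorem inner_conj {s : ℍ[ℝ]} (hs : ‖s‖ = 1) (a b : ℍ[ℝ]) :
    (inner ℝ (s * a * star s) (s * b * star s) : ℝ) = inner ℝ a b := by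
  rw [mul_assoc, mul_assoc, inner_mul_left hs]
  have h := normSq_one hs
  simp only [inner_eq, Quaternion.re_mul, Quaternion.imI_mul, Quaternion.imJ_mul,
    Quaternion.imK_mul, Quaternion.re_star, Quaternion.imI_star, Quaternion.imJ_star,
    Quaternion.imK_star]
  linear_combination (a.re * b.re + a.imI * b.imI + a.imJ * b.imJ + a.imK * b.imK) * h

theorem inner_self_mul {p : ℍ[ℝ]} (hp : ‖p‖ = 1) (a : ℍ[ℝ]) : (inner ℝ p (p * a) : ℝ) = a.re := by
  have := inner_mul_left hp 1 a
  rw [mul_one] at this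
  rw [this, inner_eq]
  simp

theorem frameVec_add (z : Amb) (s : ℍ[ℝ]) (A B : Amb) :
    frameVec z s (A + B) = frameVec z s A + frameVec z s B := by
  ext1 <;> simp [frameVec, mul_add, add_mul]

theorem frameVec_sub (z : Amb) (s : ℍ[ℝ]) (A B : Amb) :
    frameVec z s (A - B) = frameVec z s A - frameVec z s B := by
  ext1 <;> simp [frameVec, mul_sub, sub_mul]

theorem frameVec_smul (z : Amb) (s : ℍ[ℝ]) (r : ℝ) (A : Amb) :
    frameVec z s (r • A) = r • frameVec z s A := by
  ext1 <;> simp [frameVec]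

theorem isTangent_frameVec {z : Amb} (hz : OnN z) {s : ℍ[ℝ]} (hs : ‖s‖ = 1) {A : Amb}
    (hA : IsImag A) : IsTangent z (frameVec z s A) :=
  ⟨by rw [frameVec, inner_self_mul hz.1, re_conj hs, hA.1],
    by rw [frameVec, inner_self_mul hz.2, re_conj hs, hA.2]⟩

theorem exists_frameVec {z : Amb} (hz : OnN z) {s : ℍ[ℝ]} (hs : ‖s‖ = 1) {Z : Amb}
    (hZ : IsTangent z Z) : ∃ A, IsImag A ∧ Z = frameVec z s A := by
  obtain ⟨a, b, ha, hb, rfl⟩ := isTangent_frame hz hZ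
  have hs' : ‖star s‖ = 1 := by rw [norm_star, hs]
  have e : ∀ c, s * (star s * c * s) * star s = c := fun c => by
    calc _ = s * star s * c * (s * star s) := by simp only [mul_assoc]
      _ = c := by rw [mul_star_self_eq_one hs, one_mul, mul_one]
  have r : ∀ c, (star s * c * s).re = c.re := fun c => by
    have := re_conj hs' c
    rwa [star_star] at this
  refine ⟨(star s * a * s, star s * b * s), ⟨by rw [r, ha], by rw [r, hb]⟩, ?_⟩
  rw [frameVec, e, e]

theorem g_frameVec {z : Amb} (hz : OnN z) {s : ℍ[ℝ]} (hs : ‖s‖ = 1) (A B : Amb) :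
    g z (frameVec z s A) (frameVec z s B) = frameMetric A B := by
  rw [frameVec, frameVec, show z = (z.1, z.2) from rfl, g_frame _ _ _ _ _ _ hz.1 hz.2,
    inner_conj hs, inner_conj hs, inner_conj hs, inner_conj hs, frameMetric]

theorem J_frameVec {z : Amb} (hz : OnN z) (s : ℍ[ℝ]) (A : Amb) :
    J z (frameVec z s A) = (Real.sqrt 3)⁻¹ • frameVec z s (frameJ A) := by
  have e : ∀ p q : ℍ[ℝ], ‖q‖ = 1 → ∀ b, p * q⁻¹ * (q * b) = p * b := fun p q hq b => by
    rw [mul_assoc, ← mul_assoc q⁻¹, inv_mul_cancel₀ (norm_ne hq), one_mul]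
  simp only [J, frameVec, frameJ, LinearMap.coe_mk, AddHom.coe_mk, e _ _ hz.1, e _ _ hz.2]
  congr 2
  · simp only [mul_sub, sub_mul, mul_smul_comm, smul_mul_assoc]
  · simp only [mul_sub, sub_mul, mul_smul_comm, smul_mul_assoc]; abel

/-- Conjugation fixes the reals, so real coefficients give exactly the directions normal to the two
spheres. -/
theorem tanProj_frameVec {z : Amb} (hz : OnN z) {s : ℍ[ℝ]} (hs : ‖s‖ = 1) (A : Amb) :
    tanProj z (frameVec z s A) = frameVec z s (A.1 - (A.1.re : ℍ[ℝ]), A.2 - (A.2.re : ℍ[ℝ])) := by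
  have e : ∀ r : ℝ, s * (r : ℍ[ℝ]) * star s = r := fun r => by
    rw [← Quaternion.coe_commutes, mul_assoc, mul_star_self_eq_one hs, mul_one]
  have e' : ∀ (r : ℝ) (p : ℍ[ℝ]), r • p = p * r := fun r p => by
    rw [Quaternion.mul_coe_eq_smul]
  simp only [tanProj, frameVec, inner_self_mul hz.1, inner_self_mul hz.2, re_conj hs, mul_sub,
    sub_mul, e, e']

theorem lcTensor_frameVec {z : Amb} (hz : OnN z) {s : ℍ[ℝ]} (hs : ‖s‖ = 1) (N A : Amb) :
    lcTensor z (frameVec z s N) (frameVec z s A) = frameVec z s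
      (-(1 / 6 : ℝ) • ((N.1 * A.2 - A.2 * N.1) + (A.1 * N.2 - N.2 * A.1)),
        (1 / 6 : ℝ) • ((N.1 * A.2 - A.2 * N.1) + (A.1 * N.2 - N.2 * A.1))) := by
  rw [frameVec, frameVec, lcTensor_frame hz]
  simp only [conj_mul_conj hs, frameVec, mul_smul_comm, smul_mul_assoc, mul_add, add_mul, mul_sub,
    sub_mul]

theorem frameMetric_add_left (A B C : Amb) :
    frameMetric (A + B) C = frameMetric A C + frameMetric B C := by
  simp only [frameMetric, Prod.fst_add, Prod.snd_add, inner_add_left, inner_add_right]; ring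

theorem frameMetric_smul_right (r : ℝ) (A B : Amb) :
    frameMetric A (r • B) = r * frameMetric A B := by
  simp only [frameMetric, Prod.smul_fst, Prod.smul_snd, inner_smul_right, real_inner_smul_left]
  ring

theorem frameMetric_frameJ (A B : Amb) :
    frameMetric (frameJ A) (frameJ B) = 3 * frameMetric A B := by
  simp [frameMetric, frameJ, inner_eq]
  ring

theorem frameMetric_frameJ_left (A B : Amb) :
    frameMetric (frameJ A) B = -frameMetric A (frameJ B) := by
  simp [frameMetric, frameJ, inner_eq]
  ring

theorem isImag_frameJ {A : Amb} (hA : IsImag A) : IsImag (frameJ A) := by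
  simp [IsImag, frameJ, hA.1, hA.2]

/-- The derivative of a frame vector with imaginary coefficients. -/
theorem cov_frameVec {z : Amb} (hz : OnN z) {s : ℍ[ℝ]} (hs : ‖s‖ = 1) {N A A' : Amb}
    (hN : IsImag N) (hA : IsImag A) (hA' : IsImag A') (σ : ℍ[ℝ]) :
    tanProj z (frameVec z s (A' + (N.1 * A.1 + (σ * A.1 - A.1 * σ),
      N.2 * A.2 + (σ * A.2 - A.2 * σ)))) + lcTensor z (frameVec z s N) (frameVec z s A) =
    frameVec z s (A' + frameCov N σ A) := by
  rw [tanProj_frameVec hz hs, lcTensor_frameVec hz hs, ← frameVec_add]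
  congr 1
  obtain ⟨N1, N2⟩ := N
  obtain ⟨A1, A2⟩ := A
  obtain ⟨B1, B2⟩ := A'
  simp only [IsImag] at hN hA hA'
  simp only [frameCov]
  -- The product `N A` is half the commutator plus half the anticommutator. The latter is real for
  -- imaginary quaternions and is removed by `tanProj`, which leaves the factor `1 / 2` in
  -- `frameCov`.
  ext <;> simp [hN.1, hN.2, hA.1, hA.2, hA'.1, hA'.2] <;> ring

/-- Base point, conjugating quaternion and coefficients are independent variables here, so that the
chain rule applies to any such triple of functions on `M`. -/
theorem hasFDerivAt_frameVec (w : Amb × ℍ[ℝ] × Amb) {N : Amb} {σ : ℍ[ℝ]} (hσ : σ.re = 0) :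
    ∃ D : Amb × ℍ[ℝ] × Amb →L[ℝ] Amb,
      HasFDerivAt (fun w : Amb × ℍ[ℝ] × Amb => frameVec w.1 w.2.1 w.2.2) D w ∧
      (‖w.2.1‖ = 1 → ∀ A' : Amb, D (frameVec w.1 w.2.1 N, w.2.1 * σ, A') =
        frameVec w.1 w.2.1 (A' + (N.1 * w.2.2.1 + (σ * w.2.2.1 - w.2.2.1 * σ),
          N.2 * w.2.2.2 + (σ * w.2.2.2 - w.2.2.2 * σ)))) := by
  have hz : HasFDerivAt (fun w : Amb × ℍ[ℝ] × Amb => w.1) _ w := hasFDerivAt_fst (𝕜 := ℝ)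
  have hr : HasFDerivAt (fun w : Amb × ℍ[ℝ] × Amb => w.2) _ w := hasFDerivAt_snd (𝕜 := ℝ)
  have hs := hr.fst
  have hA := hr.snd
  have hss : HasFDerivAt (fun w : Amb × ℍ[ℝ] × Amb => star w.2.1) _ w :=
    starCLM.hasFDerivAt.comp w hs
  refine ⟨_, (hz.fst.mul' ((hs.mul' hA.fst).mul' hss)).prodMk
    (hz.snd.mul' ((hs.mul' hA.snd).mul' hss)), fun hw A' => ?_⟩
  -- As `σ` is imaginary, the two occurrences of `s` contribute `σ A` and `-A σ`, that is, the
  -- commutator.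
  have e : starCLM (w.2.1 * σ) = -(σ * star w.2.1) := by
    change star (w.2.1 * σ) = _
    rw [star_mul, show star σ = -σ by ext <;> simp [hσ], neg_mul]
  have k : ∀ a : ℍ[ℝ], star w.2.1 * (w.2.1 * a) = a := fun a => by
    rw [← mul_assoc, star_mul_self_eq_one hw, one_mul]
  ext1 <;>
  · simp [frameVec, e, mul_add, add_mul, mul_sub, sub_mul, mul_assoc, k]
    abel

/-! ### Lagrangian immersions with constant coefficients in a quaternionic frame -/

/-- The vector product of `ℝ³`. -/
def cross : (Fin 3 → ℝ) →ₗ[ℝ] (Fin 3 → ℝ) →ₗ[ℝ] (Fin 3 → ℝ) :=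
  LinearMap.mk₂ ℝ
    (fun a b => ![a 1 * b 2 - a 2 * b 1, a 2 * b 0 - a 0 * b 2, a 0 * b 1 - a 1 * b 0])
    (fun _ _ _ => by ext i; fin_cases i <;> simp <;> ring)
    (fun _ _ _ => by ext i; fin_cases i <;> simp <;> ring)
    (fun _ _ _ => by ext i; fin_cases i <;> simp <;> ring)
    (fun _ _ _ => by ext i; fin_cases i <;> simp <;> ring)

/-- The symmetric counterpart of the vector product. -/
def symCross : (Fin 3 → ℝ) →ₗ[ℝ] (Fin 3 → ℝ) →ₗ[ℝ] (Fin 3 → ℝ) :=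
  LinearMap.mk₂ ℝ
    (fun a b => ![a 1 * b 2 + a 2 * b 1, a 2 * b 0 + a 0 * b 2, a 0 * b 1 + a 1 * b 0])
    (fun _ _ _ => by ext i; fin_cases i <;> simp <;> ring)
    (fun _ _ _ => by ext i; fin_cases i <;> simp <;> ring)
    (fun _ _ _ => by ext i; fin_cases i <;> simp <;> ring)
    (fun _ _ _ => by ext i; fin_cases i <;> simp <;> ring)

theorem cross_self (a : Fin 3 → ℝ) : cross a a = 0 := by
  ext i; fin_cases i <;> simp [cross] <;> ring

theorem dotProduct_cross_self (a b : Fin 3 → ℝ) : cross a b ⬝ᵥ a = 0 := by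
  simp [cross, dotProduct, Fin.sum_univ_three]; ring

theorem onN_pos {M : Type*} (f : M → S3 × S3) (x : M) : OnN (pos f x) := by
  simp [OnN, pos]

section General

variable {M : Type*} [TopologicalSpace M] [ChartedSpace (EuclideanSpace ℝ (Fin 3)) M]

/-- The derivative of `c` at `x` in the direction `v`. -/
def dir {F : Type*} [NormedAddCommGroup F] [NormedSpace ℝ F] (c : M → F) (x : M)
    (v : TangentSpace (𝓡 3) x) : F :=
  mfderiv (𝓡 3) 𝓘(ℝ, F) c x v

/-- `f` has constant coefficients in the quaternionic frame given by `s`: there is a coframe `θ`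
of `M` in which the differentials of `f` and `s` are given by constant maps `ν` and `σ`. The
last two conditions give the induced connection, the second fundamental form and
the normal connection. -/
structure HasConstantFrame [IsManifold (𝓡 3) ∞ M] (f : M → S3 × S3) (s : M → ℍ[ℝ])
    (θ : ∀ x : M, TangentSpace (𝓡 3) x →ₗ[ℝ] (Fin 3 → ℝ)) (ν : (Fin 3 → ℝ) →ₗ[ℝ] Amb)
    (σ : (Fin 3 → ℝ) → ℍ[ℝ]) (γ h β : ℝ) : Prop where
  smooth_pos : ContMDiff (𝓡 3) 𝓘(ℝ, Amb) ∞ (pos f)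
  smooth_s : ContMDiff (𝓡 3) 𝓘(ℝ, ℍ[ℝ]) ∞ s
  norm_s : ∀ x, ‖s x‖ = 1
  injective : ∀ x, Function.Injective (θ x)
  df_eq : ∀ x v, df f x v = frameVec (pos f x) (s x) (ν (θ x v))
  ds_eq : ∀ x v, dir s x v = s x * σ (θ x v)
  smooth_coeff : ∀ X : ∀ x : M, TangentSpace (𝓡 3) x, IsSmoothField X →
    ContMDiff (𝓡 3) 𝓘(ℝ, Fin 3 → ℝ) ∞ fun y => θ y (X y)
  re_σ : ∀ a, (σ a).re = 0
  isImag : ∀ a, IsImag (ν a)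
  metric : ∀ a b, frameMetric (ν a) (ν b) = 4 / 3 * (a ⬝ᵥ b)
  lagrangian : ∀ a b, frameMetric (ν a) (frameJ (ν b)) = 0
  decomp : ∀ A, IsImag A → ∃ a b, A = ν a + frameJ (ν b)
  cov_tangent : ∀ a b, frameCov (ν a) (σ a) (ν b) =
    ν (γ • cross a b) + frameJ (ν (h • symCross a b))
  -- The factor `-3 h` is forced by metric compatibility, since `frameJ` multiplies the metric by
  -- `3`. In both examples `β - γ = -2 / 3`: the two connections differ by the derivative of `J`,
  -- which does not vanish as the structure is not Kähler.
  cov_normal : ∀ a b, frameCov (ν a) (σ a) (frameJ (ν b)) =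
    ν (-(3 * h) • symCross a b) + frameJ (ν (β • cross a b))

/-! ### Derivatives of vector-valued functions on `M` -/

theorem dir_comp {F G : Type*} [NormedAddCommGroup F] [NormedSpace ℝ F] [NormedAddCommGroup G]
    [NormedSpace ℝ G] {c : M → F} {φ : F → G} {D : F →L[ℝ] G} {x : M}
    (hc : MDifferentiableAt (𝓡 3) 𝓘(ℝ, F) c x) (hφ : HasFDerivAt φ D (c x))
    (v : TangentSpace (𝓡 3) x) : dir (fun y => φ (c y)) x v = D (dir c x v) := by
  have := (hφ.hasMFDerivAt.comp x hc.hasMFDerivAt).mfderiv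
  exact congrArg (fun L => L v) this

theorem dir_prodMk {F G : Type*} [NormedAddCommGroup F] [NormedSpace ℝ F] [NormedAddCommGroup G]
    [NormedSpace ℝ G] {c : M → F} {d : M → G} {x : M}
    (hc : MDifferentiableAt (𝓡 3) 𝓘(ℝ, F) c x) (hd : MDifferentiableAt (𝓡 3) 𝓘(ℝ, G) d x)
    (v : TangentSpace (𝓡 3) x) : dir (fun y => (c y, d y)) x v = (dir c x v, dir d x v) := by
  have h := hc.prodMk_space hd
  have h1 := dir_comp h (hasFDerivAt_fst (𝕜 := ℝ) (p := (c x, d x))) v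
  have h2 := dir_comp h (hasFDerivAt_snd (𝕜 := ℝ) (p := (c x, d x))) v
  exact Prod.ext h1.symm h2.symm

/-- The derivative of a smooth function along a smooth vector field is smooth. -/
theorem contMDiff_dir [IsManifold (𝓡 3) ∞ M] {F : Type*} [NormedAddCommGroup F] [NormedSpace ℝ F]
    {c : M → F} (hc : ContMDiff (𝓡 3) 𝓘(ℝ, F) ∞ c) {X : ∀ x : M, TangentSpace (𝓡 3) x}
    (hX : IsSmoothField X) : ContMDiff (𝓡 3) 𝓘(ℝ, F) ∞ fun y => dir c y (X y) := by
  have : IsManifold (𝓡 3) 1 M := IsManifold.of_le (n := ∞) (by simp)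
  have h1 := (hc.contMDiff_tangentMap (m := ∞) (by simp)).comp hX
  exact (contMDiff_snd_tangentBundle_modelSpace F 𝓘(ℝ, F)).comp h1

variable [IsManifold (𝓡 3) ∞ M] {f : M → S3 × S3} {s : M → ℍ[ℝ]}
  {θ : ∀ x : M, TangentSpace (𝓡 3) x →ₗ[ℝ] (Fin 3 → ℝ)} {ν : (Fin 3 → ℝ) →ₗ[ℝ] Amb}
  {σ : (Fin 3 → ℝ) → ℍ[ℝ]} {γ h β : ℝ}

namespace HasConstantFrame

variable (H : HasConstantFrame f s θ ν σ γ h β)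
include H

/-! ### Connections and second fundamental form in a constant frame -/

theorem surjective (x : M) : Function.Surjective (θ x) := by
  have : FiniteDimensional ℝ (TangentSpace (𝓡 3) x) :=
    inferInstanceAs (FiniteDimensional ℝ (EuclideanSpace ℝ (Fin 3)))
  refine (LinearMap.injective_iff_surjective_of_finrank_eq_finrank ?_).1 (H.injective x)
  change Module.finrank ℝ (EuclideanSpace ℝ (Fin 3)) = _
  simp

/-- Used with `l = ν` for tangent fields and `l = frameJ ∘ₗ ν` for normal fields. -/
theorem ambCov_eq (l : (Fin 3 → ℝ) →ₗ[ℝ] Amb) (hl : ∀ a, IsImag (l a)) {c : M → Fin 3 → ℝ} {x : M}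
    (hc : MDifferentiableAt (𝓡 3) 𝓘(ℝ, Fin 3 → ℝ) c x) (v : TangentSpace (𝓡 3) x) :
    ambCov f (fun y => frameVec (pos f y) (s y) (l (c y))) x v =
      frameVec (pos f x) (s x) (l (dir c x v) + frameCov (ν (θ x v)) (σ (θ x v)) (l (c x))) := by
  have hp := (H.smooth_pos x).mdifferentiableAt (by simp)
  have hs := (H.smooth_s x).mdifferentiableAt (by simp)
  have hl' : HasFDerivAt (fun a => l a) (LinearMap.toContinuousLinearMap l) (c x) :=
    (LinearMap.toContinuousLinearMap l).hasFDerivAt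
  have hlc : MDifferentiableAt (𝓡 3) 𝓘(ℝ, Amb) (fun y => l (c y)) x :=
    hl'.differentiableAt.comp_mdifferentiableAt hc
  obtain ⟨D, hD, hD'⟩ := hasFDerivAt_frameVec (pos f x, s x, l (c x)) (N := ν (θ x v))
    (H.re_σ (θ x v))
  have key := dir_comp (hp.prodMk_space (hs.prodMk_space hlc)) hD v
  rw [dir_prodMk hp (hs.prodMk_space hlc), dir_prodMk hs hlc, dir_comp hc hl',
    show dir (pos f) x v = _ from H.df_eq x v, H.ds_eq, hD' (H.norm_s x)] at key
  have e : mfderiv (𝓡 3) 𝓘(ℝ, Amb) (fun y => frameVec (pos f y) (s y) (l (c y))) x v = _ := key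
  rw [ambCov, e, H.df_eq]
  exact cov_frameVec (onN_pos f x) (H.norm_s x) (H.isImag _) (hl _) (hl _) _

/-- The condition under `Classical.epsilon` reads `(a - θ ξ) ⬝ᵥ θ η = 0` for all `η`. It is solvable
because `θ x` is onto, and positivity of the dot product determines `θ ξ`. -/
theorem tangentialPart_eq (x : M) (a b : Fin 3 → ℝ) :
    θ x (tangentialPart f x (frameVec (pos f x) (s x) (ν a + frameJ (ν b)))) = a := by
  set W := frameVec (pos f x) (s x) (ν a + frameJ (ν b)) with hW
  have key : ∀ ξ η : TangentSpace (𝓡 3) x, g (pos f x) (W - df f x ξ) (df f x η) =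
      4 / 3 * ((a - θ x ξ) ⬝ᵥ θ x η) := by
    intro ξ η
    rw [H.df_eq, H.df_eq, hW, ← frameVec_sub, g_frameVec (onN_pos f x) (H.norm_s x),
      add_sub_right_comm, ← map_sub, frameMetric_add_left, H.metric, frameMetric_frameJ_left,
      H.lagrangian, neg_zero, add_zero]
  have hex : ∃ ξ : TangentSpace (𝓡 3) x, ∀ η : TangentSpace (𝓡 3) x,
      g (pos f x) (W - df f x ξ) (df f x η) = 0 := by
    obtain ⟨ξ, hξ⟩ := H.surjective x a
    exact ⟨ξ, fun η => by rw [key, hξ, sub_self, zero_dotProduct, mul_zero]⟩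
  have hspec : ∀ η : TangentSpace (𝓡 3) x,
      g (pos f x) (W - df f x (tangentialPart f x W)) (df f x η) = 0 :=
    Classical.epsilon_spec hex
  -- Testing against the discrepancy itself shows that its square vanishes.
  obtain ⟨η, hη⟩ := H.surjective x (a - θ x (tangentialPart f x W))
  have h0 := hspec η
  rw [key, hη] at h0
  exact (sub_eq_zero.1 (dotProduct_self_eq_zero.1 (by linarith))).symm

theorem normalPart_eq (x : M) (a b : Fin 3 → ℝ) :
    normalPart f x (frameVec (pos f x) (s x) (ν a + frameJ (ν b))) =
      frameVec (pos f x) (s x) (frameJ (ν b)) := by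
  rw [normalPart, H.df_eq, H.tangentialPart_eq, ← frameVec_sub, add_sub_cancel_left]

theorem ambCov_df {Y : ∀ x : M, TangentSpace (𝓡 3) x} {x : M}
    (hY : MDifferentiableAt (𝓡 3) 𝓘(ℝ, Fin 3 → ℝ) (fun y => θ y (Y y)) x)
    (v : TangentSpace (𝓡 3) x) :
    ambCov f (fun y => df f y (Y y)) x v = frameVec (pos f x) (s x)
      (ν (dir (fun y => θ y (Y y)) x v + γ • cross (θ x v) (θ x (Y x)))
        + frameJ (ν (h • symCross (θ x v) (θ x (Y x))))) := by
  simp only [H.df_eq]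
  rw [H.ambCov_eq ν H.isImag hY, H.cov_tangent, map_add, add_assoc]

theorem θ_indCov {Y : ∀ x : M, TangentSpace (𝓡 3) x} {x : M}
    (hY : MDifferentiableAt (𝓡 3) 𝓘(ℝ, Fin 3 → ℝ) (fun y => θ y (Y y)) x)
    (v : TangentSpace (𝓡 3) x) :
    θ x (indCov f Y x v) =
      dir (fun y => θ y (Y y)) x v + γ • cross (θ x v) (θ x (Y x)) := by
  rw [indCov, H.ambCov_df hY, H.tangentialPart_eq]

theorem secondFF_eq (X : ∀ x : M, TangentSpace (𝓡 3) x) {Y : ∀ x : M, TangentSpace (𝓡 3) x} {x : M}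
    (hY : MDifferentiableAt (𝓡 3) 𝓘(ℝ, Fin 3 → ℝ) (fun y => θ y (Y y)) x) :
    secondFF f X Y x = frameVec (pos f x) (s x)
      (frameJ (ν (h • symCross (θ x (X x)) (θ x (Y x))))) := by
  rw [secondFF, H.ambCov_df hY, H.normalPart_eq]

/-- The `-3 h` term of `cov_normal` is tangential, so only the `β` term survives the projection. -/
theorem normalCov_eq {c : M → Fin 3 → ℝ} {x : M}
    (hc : MDifferentiableAt (𝓡 3) 𝓘(ℝ, Fin 3 → ℝ) c x) (v : TangentSpace (𝓡 3) x) :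
    normalCov f (fun y => frameVec (pos f y) (s y) (frameJ (ν (c y)))) x v =
      frameVec (pos f x) (s x) (frameJ (ν (dir c x v + β • cross (θ x v) (c x)))) := by
  have := H.ambCov_eq (frameJ ∘ₗ ν) (fun a => isImag_frameJ (H.isImag a)) hc v
  simp only [LinearMap.comp_apply] at this
  rw [normalCov, this, H.cov_normal, add_left_comm, ← map_add, ← map_add, H.normalPart_eq]

/-- The derivatives of the coefficients of the vector fields cancel in `∇h`. -/
theorem covSecondFF_self {X : ∀ x : M, TangentSpace (𝓡 3) x} (hX : IsSmoothField X) (x : M) :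
    covSecondFF f X X X x = frameVec (pos f x) (s x) (frameJ (ν
      ((β * h) • cross (θ x (X x)) (symCross (θ x (X x)) (θ x (X x)))))) := by
  have sm := H.smooth_coeff X hX
  have md : MDifferentiable (𝓡 3) 𝓘(ℝ, Fin 3 → ℝ) fun y => θ y (X y) :=
    sm.mdifferentiable (by simp)
  let B : (Fin 3 → ℝ) →L[ℝ] (Fin 3 → ℝ) →L[ℝ] (Fin 3 → ℝ) :=
    (h • symCross).toContinuousBilinearMap
  have hB : ∀ a b, B a b = h • symCross a b := fun _ _ => rfl
  have hBd := B.hasFDerivAt_of_bilinear (hasFDerivAt_id (𝕜 := ℝ) (θ x (X x)))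
    (hasFDerivAt_id (𝕜 := ℝ) (θ x (X x)))
  simp only [hB, id] at hBd
  have hn : secondFF f X X = fun y => frameVec (pos f y) (s y)
      (frameJ (ν (h • symCross (θ y (X y)) (θ y (X y))))) :=
    funext fun y => H.secondFF_eq X (md y)
  have hcc : MDifferentiableAt (𝓡 3) 𝓘(ℝ, Fin 3 → ℝ)
      (fun y => h • symCross (θ y (X y)) (θ y (X y))) x :=
    hBd.differentiableAt.comp_mdifferentiableAt (f := fun y => θ y (X y)) (md x)
  -- In `∇_X X` the connection term is `γ a × a = 0`, so its coefficients are the derivative of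
  -- those of `X` along `X`.
  have hi : (fun y => θ y (indCov f X y (X y))) = fun y => dir (fun y => θ y (X y)) y (X y) := by
    funext y
    rw [H.θ_indCov (md y), cross_self, smul_zero, add_zero]
  -- The formula for `secondFF f X (∇_X X)` needs differentiable coefficients of its second
  -- argument.
  have hid : MDifferentiableAt (𝓡 3) 𝓘(ℝ, Fin 3 → ℝ) (fun y => θ y (indCov f X y (X y))) x := by
    rw [hi]
    exact (contMDiff_dir sm hX x).mdifferentiableAt (by simp)
  rw [covSecondFF, hn, H.normalCov_eq hcc, H.secondFF_eq _ (md x), H.secondFF_eq X hid,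
    dir_comp (md x) hBd, ← frameVec_sub, ← frameVec_sub, ← map_sub, ← map_sub, ← map_sub,
    ← map_sub, congrFun hi x]
  congr 3
  simp [hB, mul_smul]
  abel

/-! ### The Lagrangian property, the `J`-parallel property and total geodesy -/

theorem isLagrangianImmersion (hf : ContMDiff (𝓡 3) ((𝓡 3).prod (𝓡 3)) ∞ f) :
    IsLagrangianImmersion f where
  smooth := hf
  immersion x := by
    -- `df` factors through the differential of `f` into `S3 × S3`, so a kernel vector of the latter
    -- has zero `df`; its `θ`-coefficients then have zero length.
    let ι : S3 × S3 → Amb := fun w => (w.1, w.2)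
    have hι : ContMDiff ((𝓡 3).prod (𝓡 3)) 𝓘(ℝ, Amb) ∞ ι :=
      (contMDiff_coe_sphere.comp contMDiff_fst).prodMk_space
        (contMDiff_coe_sphere.comp contMDiff_snd)
    have hc := mfderiv_comp x ((hι (f x)).mdifferentiableAt (by simp))
      ((hf x).mdifferentiableAt (by simp))
    have hd : ∀ v, df f x v = mfderiv ((𝓡 3).prod (𝓡 3)) 𝓘(ℝ, Amb) ι (f x)
        (mfderiv (𝓡 3) ((𝓡 3).prod (𝓡 3)) f x v) := fun v => congrArg (fun L => L v) hc
    rw [injective_iff_map_eq_zero]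
    intro v hv
    have h0 : df f x v = 0 := by rw [hd, hv]; exact map_zero _
    have h1 := g_frameVec (onN_pos f x) (H.norm_s x) (ν (θ x v)) (ν (θ x v))
    rw [← H.df_eq, h0, H.metric] at h1
    have h2 : g (pos f x) 0 0 = 0 := by simp [g, prodMetric, J]
    rw [h2] at h1
    exact H.injective x ((dotProduct_self_eq_zero.1 (by linarith)).trans (map_zero _).symm)
  lagrangian x := by
    have hz := onN_pos f x
    have hs := H.norm_s x
    have h3 : (Real.sqrt 3)⁻¹ ≠ 0 := by positivity
    ext Z
    simp only [Set.mem_ofPred_eq, H.df_eq, J_frameVec hz, ← frameVec_smul]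
    constructor
    · rintro ⟨v, rfl⟩
      refine ⟨isTangent_frameVec hz hs ?_, fun w => ?_⟩
      · rw [← map_smul, ← map_smul]
        exact isImag_frameJ (H.isImag _)
      · rw [g_frameVec hz hs, ← map_smul, ← map_smul, frameMetric_frameJ_left, H.lagrangian,
          neg_zero]
    · rintro ⟨hZ, hn⟩
      obtain ⟨A, hA, rfl⟩ := exists_frameVec hz hs hZ
      obtain ⟨a, b, rfl⟩ := H.decomp A hA
      obtain ⟨v, hv⟩ := H.surjective x a
      have h0 := hn v
      rw [g_frameVec hz hs, frameMetric_add_left, H.metric, frameMetric_frameJ_left, H.lagrangian,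
        hv, neg_zero, add_zero] at h0
      have ha : a = 0 := dotProduct_self_eq_zero.1 (by linarith)
      -- The factor `√3` offsets `J = frameJ / √3`.
      obtain ⟨w, hw⟩ := H.surjective x ((Real.sqrt 3)⁻¹⁻¹ • b)
      refine ⟨w, ?_⟩
      rw [hw, ha, map_zero, zero_add, map_smul, map_smul, smul_inv_smul₀ h3]

theorem isJParallel (hf : ContMDiff (𝓡 3) ((𝓡 3).prod (𝓡 3)) ∞ f) : IsJParallel f where
  toIsLagrangianImmersion := H.isLagrangianImmersion hf
  isotropic X hX x := by
    rw [H.covSecondFF_self hX, H.df_eq, J_frameVec (onN_pos f x), ← frameVec_smul,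
      g_frameVec (onN_pos f x) (H.norm_s x), frameMetric_smul_right, frameMetric_frameJ, H.metric,
      smul_dotProduct, dotProduct_cross_self]
    simp

theorem not_isTotallyGeodesic (hh : h ≠ 0) {x : M}
    (hext : ∀ v : TangentSpace (𝓡 3) x, ∃ X : ∀ x : M, TangentSpace (𝓡 3) x,
      IsSmoothField X ∧ X x = v) : ¬ IsTotallyGeodesic f := by
  intro ht
  -- For this vector `a ∘ a = (2, 2, 2)`, whereas it vanishes on the coordinate axes.
  obtain ⟨v, hv⟩ := H.surjective x ![1, 1, 1]
  obtain ⟨X, hX, hXv⟩ := hext v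
  have h0 := ht X X hX hX x
  rw [H.secondFF_eq X ((H.smooth_coeff X hX x).mdifferentiableAt (by simp)), hXv, hv] at h0
  have h1 := g_frameVec (onN_pos f x) (H.norm_s x)
    (frameJ (ν (h • symCross ![1, 1, 1] ![1, 1, 1])))
    (frameJ (ν (h • symCross ![1, 1, 1] ![1, 1, 1])))
  have h2 : g (pos f x) 0 0 = 0 := by simp [g, prodMetric, J]
  rw [h0, h2, frameMetric_frameJ, H.metric] at h1
  have h3 := congrFun (dotProduct_self_eq_zero.1
    (show h • symCross ![1, 1, 1] ![1, 1, 1] ⬝ᵥ h • symCross ![1, 1, 1] ![1, 1, 1] = 0 by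
      linarith)) 0
  simp [symCross, hh] at h3

end HasConstantFrame

end General

/-! ### Smoothness into the spheres and extension of tangent vectors -/

section General

variable {M : Type*} [TopologicalSpace M] [ChartedSpace (EuclideanSpace ℝ (Fin 3)) M]
  [IsManifold (𝓡 3) ∞ M]

theorem contMDiff_of_pos {f : M → S3 × S3} (hf : ContMDiff (𝓡 3) 𝓘(ℝ, Amb) ∞ (pos f)) :
    ContMDiff (𝓡 3) ((𝓡 3).prod (𝓡 3)) ∞ f :=
  ((contDiff_fst.contMDiff.comp hf).codRestrict_sphere (fun x => (f x).1.2)).prodMk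
    ((contDiff_snd.contMDiff.comp hf).codRestrict_sphere (fun x => (f x).2.2))

/-- Every tangent vector extends to a smooth vector field. -/
theorem exists_isSmoothField [T2Space M] (x : M) (v : TangentSpace (𝓡 3) x) :
    ∃ X : ∀ x : M, TangentSpace (𝓡 3) x, IsSmoothField X ∧ X x = v := by
  obtain ⟨t, ht, hext⟩ := FiberBundle.exists_contMDiffOn_extend (k := ∞) (𝓡 3)
    (EuclideanSpace ℝ (Fin 3)) (V := fun x : M => TangentSpace (𝓡 3) x) v
  -- The local extension is smooth only near `x`; a bump function supported there and equal to `1`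
  -- at `x` makes it global.
  obtain ⟨ψ, -, hψ⟩ := (SmoothBumpFunction.nhds_basis_tsupport (I := 𝓡 3) x).mem_iff.1
    (interior_mem_nhds.2 ht)
  refine ⟨fun y => ψ y • FiberBundle.extend (EuclideanSpace ℝ (Fin 3)) v y, ?_, ?_⟩
  · exact ContMDiffOn.smul_section_of_tsupport ψ.contMDiff.contMDiffOn isOpen_interior hψ
      (hext.mono interior_subset)
  · simp

end General

/-- The quaternion with the given components. -/
def quat (a b c d : ℝ) : ℍ[ℝ] := ⟨a, b, c, d⟩

section Components

variable (a b c d : ℝ)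

@[simp] theorem re_quat : (quat a b c d).re = a := rfl
@[simp] theorem imI_quat : (quat a b c d).imI = b := rfl
@[simp] theorem imJ_quat : (quat a b c d).imJ = c := rfl
@[simp] theorem imK_quat : (quat a b c d).imK = d := rfl
@[simp] theorem re_qi : qi.re = 0 := rfl
@[simp] theorem imI_qi : qi.imI = 1 := rfl
@[simp] theorem imJ_qi : qi.imJ = 0 := rfl
@[simp] theorem imK_qi : qi.imK = 0 := rfl
@[simp] theorem re_qj : qj.re = 0 := rfl
@[simp] theorem imI_qj : qj.imI = 0 := rfl
@[simp] theorem imJ_qj : qj.imJ = 1 := rfl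
@[simp] theorem imK_qj : qj.imK = 0 := rfl

end Components

/-! ### The immersion `f₇` -/

/-- The differential of `f₇` in a quaternionic frame. -/
def ν7 : (Fin 3 → ℝ) →ₗ[ℝ] Amb where
  -- With `p = u i u⁻¹` and `du = u σ`, one has `p⁻¹ dp = u (-i [σ, i]) u⁻¹`, and likewise for `q`
  -- with `j`; here `σ = σ7 a`.
  toFun a := (quat 0 0 (-a 1) (-a 2), quat 0 (-a 0) 0 (-a 2))
  map_add' a b := by ext <;> simp <;> ring
  map_smul' r a := by ext <;> simp

/-- The velocity of the frame of `f₇`. -/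
def σ7 (a : Fin 3 → ℝ) : ℍ[ℝ] := quat 0 (a 0 / 2) (a 1 / 2) (a 2 / 2)

/-- Twice the imaginary part of `p⁻¹ U`, as a linear function of `U`. -/
def imCoeff (p : ℍ[ℝ]) : ℍ[ℝ] →ₗ[ℝ] (Fin 3 → ℝ) where
  -- The factor `2`, undone by the halves in `σ7`, normalises the induced metric to `4 / 3` times
  -- the dot product.
  toFun U := ![2 * (star p * U).imI, 2 * (star p * U).imJ, 2 * (star p * U).imK]
  map_add' a b := by ext i; fin_cases i <;> simp <;> ring
  map_smul' r a := by ext i; fin_cases i <;> simp <;> ring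

/-- The inclusion of `S³` in the quaternions. -/
def incl (u : S3) : ℍ[ℝ] := u

/-- The left-invariant coframe of `S³`. -/
def θ7 (u : S3) : TangentSpace (𝓡 3) u →ₗ[ℝ] (Fin 3 → ℝ) :=
  imCoeff u ∘ₗ (mfderiv (𝓡 3) 𝓘(ℝ, ℍ[ℝ]) incl u).toLinearMap

theorem contMDiff_incl : ContMDiff (𝓡 3) 𝓘(ℝ, ℍ[ℝ]) ∞ incl := contMDiff_coe_sphere

theorem norm_incl (u : S3) : ‖incl u‖ = 1 := by simp [incl]

/-- Since `du` is orthogonal to `u`, the quaternion `u⁻¹ du` is imaginary and is recovered from its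
three imaginary components. -/
theorem dir_incl (u : S3) (v : TangentSpace (𝓡 3) u) :
    dir incl u v = incl u * σ7 (θ7 u v) := by
  have hr : inner ℝ (incl u) (dir incl u v) = 0 := by
    have h := LinearMap.mem_range_self (mvfderiv (𝓡 3) ((↑) : S3 → ℍ[ℝ]) u).toLinearMap v
    have h2 := range_mvfderiv_subtypeVal (n := 3) u
    have h3 : dir incl u v ∈ (Submodule.span ℝ {(u : ℍ[ℝ])})ᗮ := by
      rw [← h2]; exact h
    exact Submodule.mem_orthogonal_singleton_iff_inner_right.1 h3
  have e : σ7 (θ7 u v) = star (incl u) * dir incl u v := by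
    have : (star (incl u) * dir incl u v).re = 0 := by
      rw [inner_eq] at hr
      simp; linarith
    change σ7 (imCoeff (incl u) (dir incl u v)) = _
    ext
    · simp [σ7, this]
    all_goals simp [σ7, imCoeff]
  rw [e, ← mul_assoc, mul_star_self_eq_one (norm_incl u), one_mul]

/-- Conjugation of `a` by `w`. -/
def conjBy (a w : ℍ[ℝ]) : ℍ[ℝ] := w * a * star w

theorem contDiff_conjBy (a : ℍ[ℝ]) : ContDiff ℝ ∞ (conjBy a) :=
  (contDiff_id.mul contDiff_const).mul starCLM.contDiff

theorem hasFDerivAt_conjBy (a w : ℍ[ℝ]) : ∃ D : ℍ[ℝ] →L[ℝ] ℍ[ℝ], HasFDerivAt (conjBy a) D w ∧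
    ∀ σ : ℍ[ℝ], σ.re = 0 → D (w * σ) = w * (σ * a - a * σ) * star w := by
  refine ⟨_, ((hasFDerivAt_id w).mul' (hasFDerivAt_const a w)).mul' starCLM.hasFDerivAt,
    fun σ hσ => ?_⟩
  have e : starCLM (w * σ) = -(σ * star w) := by
    change star (w * σ) = _
    rw [star_mul, show star σ = -σ by ext <;> simp [hσ], neg_mul]
  simp [e, mul_sub, sub_mul, mul_assoc]
  abel

theorem pos_f7 : pos f7 = fun u => (conjBy qi (incl u), conjBy qj (incl u)) := by
  funext u
  have h : (u : ℍ[ℝ])⁻¹ = star (u : ℍ[ℝ]) := inv_eq_star (norm_incl u)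
  simp only [pos, f7, conjBy, incl, h]

/-- Exhibits the coframe as a smooth function of `u` and `du`, from which smoothness of coefficients
follows. -/
theorem θ7_apply (u : S3) (v : TangentSpace (𝓡 3) u) :
    θ7 u v = imCoeff 1 (star (incl u) * dir incl u v) := by
  change imCoeff (incl u) (dir incl u v) = _
  simp only [imCoeff, LinearMap.coe_mk, AddHom.coe_mk, star_one, one_mul]

theorem contDiff_imCoeff :
    ContDiff ℝ ∞ fun w : ℍ[ℝ] × ℍ[ℝ] => imCoeff 1 (star w.1 * w.2) :=
  (LinearMap.toContinuousLinearMap (imCoeff 1)).contDiff.comp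
    ((starCLM.contDiff.comp contDiff_fst).mul contDiff_snd)

theorem contMDiff_θ7 {X : ∀ u : S3, TangentSpace (𝓡 3) u} (hX : IsSmoothField X) :
    ContMDiff (𝓡 3) 𝓘(ℝ, Fin 3 → ℝ) ∞ fun u => θ7 u (X u) := by
  have h1 := contMDiff_dir contMDiff_incl hX
  have h2 := contDiff_imCoeff.contMDiff.comp (contMDiff_incl.prodMk_space h1)
  rw [funext fun u => θ7_apply u (X u)]
  exact h2

/-- The induced metric is bi-invariant on `S³`, so `∇_X Y = [X, Y] / 2` on left-invariant fields; in
this coframe the bracket is the vector product, whence `γ = 1 / 2`. -/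
theorem hasConstantFrame_f7 :
    HasConstantFrame f7 incl θ7 ν7 σ7 (1 / 2) (1 / 6) (-(1 / 6)) where
  smooth_pos := by
    rw [pos_f7]
    exact ((contDiff_conjBy qi).contMDiff.comp contMDiff_incl).prodMk_space
      ((contDiff_conjBy qj).contMDiff.comp contMDiff_incl)
  smooth_s := contMDiff_incl
  norm_s := norm_incl
  injective u := by
    rw [injective_iff_map_eq_zero]
    intro v hv
    have h := dir_incl u v
    rw [hv, show σ7 0 = 0 by ext <;> simp [σ7], mul_zero] at h
    exact injective_mvfderiv_subtypeVal_sphere (n := 3) u (h.trans (map_zero _).symm)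
  df_eq u v := by
    obtain ⟨D, hD, hD'⟩ := hasFDerivAt_conjBy qi (incl u)
    obtain ⟨E, hE, hE'⟩ := hasFDerivAt_conjBy qj (incl u)
    have md := (contMDiff_incl u).mdifferentiableAt (by simp)
    have h := dir_comp md (hD.prodMk hE) v
    rw [← pos_f7, ContinuousLinearMap.prod_apply, dir_incl, hD' _ rfl, hE' _ rfl] at h
    refine Eq.trans h ?_
    have hu := norm_incl u
    rw [frameVec, pos_f7]
    simp only [conjBy, conj_mul_conj hu]
    congr 4 <;> ext <;> simp [σ7, ν7] <;> ring
  ds_eq := dir_incl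
  smooth_coeff _ hX := contMDiff_θ7 hX
  re_σ _ := rfl
  isImag _ := ⟨rfl, rfl⟩
  metric a b := by
    simp [frameMetric, ν7, inner_eq, dotProduct, Fin.sum_univ_three]; ring
  lagrangian a b := by
    simp [frameMetric, frameJ, ν7, inner_eq]; ring
  decomp := by
    rintro ⟨A, B⟩ ⟨hA, hB⟩
    dsimp only at hA hB
    -- The `i` part of `A` involves only `b 0`, and the `j` part of `B` only `b 1`; the two `k`
    -- parts have sum `-2 a 2` and difference `2 b 2`.
    refine ⟨![A.imI / 2 - B.imI, B.imJ / 2 - A.imJ, -(A.imK + B.imK) / 2],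
      ![-A.imI / 2, B.imJ / 2, (B.imK - A.imK) / 2], ?_⟩
    ext <;> simp [ν7, frameJ, hA, hB] <;> ring
  cov_tangent a b := by
    ext <;> simp [frameCov, ν7, σ7, frameJ, cross, symCross] <;> ring
  cov_normal a b := by
    ext <;> simp [frameCov, ν7, σ7, frameJ, cross, symCross] <;> ring

/-! ### The immersion `f₈` -/

/-- The differential of `f₈` in a quaternionic frame. -/
def ν8 : (Fin 3 → ℝ) →ₗ[ℝ] Amb where
  -- From `p = exp(c i) exp(a j)` and `s = exp(-a j)` one gets `p⁻¹ dp = s (i dc + j da) s⁻¹`. For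
  -- `q` the extra factor `κ` turns `i` into `κ⁻¹ i κ = -k` and fixes `j`.
  toFun a := (quat 0 (a 2) (a 0) 0, quat 0 0 (a 0) (-a 1))
  map_add' a b := by ext <;> simp; ring
  map_smul' r a := by ext <;> simp

/-- The velocity of the frame of `f₈`. -/
def σ8 (a : Fin 3 → ℝ) : ℍ[ℝ] := quat 0 0 (-a 0) 0

/-- The coordinates of `ℝ³` scaled by `√3 / 2`. -/
def coord : EuclideanSpace ℝ (Fin 3) →L[ℝ] (Fin 3 → ℝ) :=
  (√3 / 2) • (EuclideanSpace.equiv (Fin 3) ℝ).toContinuousLinearMap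

/-- The coframe of `ℝ³` given by the scaled coordinates. -/
def θ8 (x : EuclideanSpace ℝ (Fin 3)) : TangentSpace (𝓡 3) x →ₗ[ℝ] (Fin 3 → ℝ) :=
  coord.toLinearMap

/-- The exponential `cos r + sin r u`. -/
def cexp (u : ℍ[ℝ]) (r : ℝ) : ℍ[ℝ] := Real.cos r • (1 : ℍ[ℝ]) + Real.sin r • u

theorem hasDerivAt_cexp {u : ℍ[ℝ]} (hu : u * u = -1) (r : ℝ) :
    HasDerivAt (cexp u) (u * cexp u r) r := by
  refine (((Real.hasDerivAt_cos r).smul_const (1 : ℍ[ℝ])).add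
    ((Real.hasDerivAt_sin r).smul_const u)).congr_deriv ?_
  simp only [cexp, mul_add, mul_smul_comm, mul_one, hu]
  module

theorem contDiff_cexp (u : ℍ[ℝ]) : ContDiff ℝ ∞ (cexp u) :=
  (Real.contDiff_cos.smul contDiff_const).add (Real.contDiff_sin.smul contDiff_const)

theorem qi_mul_qi : qi * qi = -1 := by ext <;> simp

theorem qj_mul_qj : qj * qj = -1 := by ext <;> simp

theorem norm_cexp_qj (r : ℝ) : ‖cexp qj r‖ = 1 :=
  mem_sphere_zero_iff_norm.1 (mem_S3 (by simp [cexp]))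

theorem star_cexp_qj (r : ℝ) : star (cexp qj r) = cexp qj (-r) := by
  ext <;> simp [cexp]

theorem cexp_comm (u : ℍ[ℝ]) (r : ℝ) : u * cexp u r = cexp u r * u := by
  simp [cexp, mul_add, add_mul]

/-- The quaternion `(1 - j) / √2`. -/
def κ : ℍ[ℝ] := (1 / √2) • (1 - qj)

/-- The map `f₈` in scaled coordinates. -/
def map8 (t : Fin 3 → ℝ) : Amb :=
  (cexp qi (t 2) * cexp qj (t 0), cexp qi (t 1) * cexp qj (t 0) * κ)

/-- Multiplying `cos a + sin a j` by `κ = exp(-π j / 4)` gives the combinations `sin a ± cos a` of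
the torus `q`. -/
theorem pos_f8 : pos f8 = fun x => map8 (coord x) := by
  funext x
  have e : ∀ i, coord x i = √3 * x i / 2 := fun i => by simp [coord]; ring
  simp only [pos, f8, map8, e]
  ext <;> simp [torusP, torusQ, cexp, κ] <;> ring

theorem contDiff_map8 : ContDiff ℝ ∞ map8 := by
  have h : ∀ u i, ContDiff ℝ ∞ fun t : Fin 3 → ℝ => cexp u (t i) := fun u i =>
    (contDiff_cexp u).comp (contDiff_apply ℝ ℝ i)
  exact ((h _ _).mul (h _ _)).prodMk (((h _ _).mul (h _ _)).mul contDiff_const)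

theorem hasFDerivAt_cexp_apply {u : ℍ[ℝ]} (hu : u * u = -1) (i : Fin 3) (t : Fin 3 → ℝ) :
    HasFDerivAt (fun t : Fin 3 → ℝ => cexp u (t i))
      ((ContinuousLinearMap.proj (R := ℝ) (φ := fun _ : Fin 3 => ℝ) i).smulRight
        (u * cexp u (t i))) t := by
  refine ((hasDerivAt_cexp hu (t i)).hasFDerivAt.comp (f := fun t : Fin 3 → ℝ => t i) t
    (hasFDerivAt_apply (𝕜 := ℝ) i t)).congr_fderiv ?_
  ext1 v
  simp

/-- In each component the factor `exp(a j)` is moved to the right of the imaginary direction, which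
becomes the conjugation by `s = exp(-a j)`. This works for `q` because `κ` commutes with `exp(a j)`.
-/
theorem hasFDerivAt_map8 (t : Fin 3 → ℝ) : ∃ D : (Fin 3 → ℝ) →L[ℝ] Amb, HasFDerivAt map8 D t ∧
    ∀ a, D a = frameVec (map8 t) (cexp qj (-t 0)) (ν8 a) := by
  have hi := hasFDerivAt_cexp_apply qi_mul_qi
  have hj := hasFDerivAt_cexp_apply qj_mul_qj
  refine ⟨_, ((hi 2 t).mul' (hj 0 t)).prodMk
    (((hi 1 t).mul' (hj 0 t)).mul' (hasFDerivAt_const κ t)), fun a => ?_⟩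
  have k1 : cexp qj (t 0) * cexp qj (-t 0) = 1 := by
    rw [← star_cexp_qj, mul_star_self_eq_one (norm_cexp_qj _)]
  have k2 : cexp qj (t 0) * κ = κ * cexp qj (t 0) := by
    ext <;> simp [cexp, κ]; ring
  -- Conjugation by `κ` is a quarter turn about `j`; hence the `k` direction in `ν8`.
  have k3 : qi * κ = -(κ * quat 0 0 0 1) := by
    ext <;> simp [κ]
  have n1 : (ν8 a).1 = a 0 • qj + a 2 • qi := by ext <;> simp [ν8]
  have n2 : (ν8 a).2 = a 0 • qj - a 1 • quat 0 0 0 1 := by ext <;> simp [ν8]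
  have hs : star (cexp qj (-t 0)) = cexp qj (t 0) := by rw [star_cexp_qj, neg_neg]
  rw [frameVec, hs, n1, n2, map8]
  ext1
  · calc _ = cexp qi (t 2) * (a 0 • (qj * cexp qj (t 0)))
          + (a 2 • (qi * cexp qi (t 2))) * cexp qj (t 0) := by simp
      _ = cexp qi (t 2) * (cexp qj (t 0) * cexp qj (-t 0)) * (a 0 • qj + a 2 • qi)
          * cexp qj (t 0) := by
        rw [k1, cexp_comm qi]
        simp only [mul_one, mul_add, add_mul, mul_smul_comm, smul_mul_assoc, mul_assoc]
      _ = _ := by simp only [mul_assoc]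
  · calc _ = (cexp qi (t 1) * (a 0 • (qj * cexp qj (t 0)))
          + (a 1 • (qi * cexp qi (t 1))) * cexp qj (t 0)) * κ := by simp [add_mul]
      _ = cexp qi (t 1) * (a 0 • (qj * (cexp qj (t 0) * κ)))
          + a 1 • (cexp qi (t 1) * qi * (cexp qj (t 0) * κ)) := by
        rw [cexp_comm qi]
        simp only [add_mul, mul_smul_comm, smul_mul_assoc, mul_assoc]
      _ = cexp qi (t 1) * (a 0 • ((qj * κ) * cexp qj (t 0)))
          + a 1 • (cexp qi (t 1) * (qi * κ) * cexp qj (t 0)) := by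
        rw [k2]; simp only [mul_assoc]
      _ = cexp qi (t 1) * κ * (cexp qj (t 0) * cexp qj (-t 0)) * (a 0 • qj - a 1 • quat 0 0 0 1)
          * cexp qj (t 0) := by
        have k4 : qj * κ = κ * qj := by ext <;> simp [κ]
        rw [k1, k3, k4]
        simp only [mul_one, mul_add, add_mul, mul_smul_comm, smul_mul_assoc, mul_assoc, mul_neg,
          neg_mul, smul_neg, sub_eq_add_neg]
      _ = _ := by
        rw [mul_assoc (cexp qi (t 1)) _ κ, k2]
        simp only [mul_assoc]

theorem dir_coord (x : EuclideanSpace ℝ (Fin 3)) (v : TangentSpace (𝓡 3) x) :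
    dir coord x v = θ8 x v := by
  have := coord.hasFDerivAt (x := x)
  exact congrArg (fun L => L v) this.hasMFDerivAt.mfderiv

theorem contMDiff_coord : ContMDiff (𝓡 3) 𝓘(ℝ, Fin 3 → ℝ) ∞ coord := coord.contDiff.contMDiff

/-- The coframe consists of scaled coordinate differentials and the induced metric has constant
coefficients in it, so the metric is flat and `γ = 0`. -/
theorem hasConstantFrame_f8 :
    HasConstantFrame f8 (fun x => cexp qj (-coord x 0)) θ8 ν8 σ8 0 (-(1 / 3)) (-(2 / 3)) where
  smooth_pos := by
    rw [pos_f8]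
    exact contDiff_map8.contMDiff.comp contMDiff_coord
  smooth_s := ((contDiff_cexp qj).comp (contDiff_apply ℝ ℝ (0 : Fin 3)).neg).contMDiff.comp
    contMDiff_coord
  norm_s _ := norm_cexp_qj _
  injective x v w hvw := by
    have h : coord v = coord w := hvw
    have h3 : (√3 / 2 : ℝ) ≠ 0 := by positivity
    exact (EuclideanSpace.equiv (Fin 3) ℝ).injective (smul_right_injective _ h3 h)
  df_eq x v := by
    obtain ⟨D, hD, hD'⟩ := hasFDerivAt_map8 (coord x)
    have h := dir_comp ((contMDiff_coord x).mdifferentiableAt (by simp)) hD v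
    rw [← pos_f8, hD', dir_coord] at h
    rw [congrFun pos_f8 x]
    exact h
  ds_eq x v := by
    have hd := (hasDerivAt_cexp qj_mul_qj (-coord x 0)).hasFDerivAt.comp
      (f := fun t : Fin 3 → ℝ => -t 0) (coord x)
      (hasFDerivAt_apply (𝕜 := ℝ) (0 : Fin 3) (coord x)).neg
    have h := dir_comp ((contMDiff_coord x).mdifferentiableAt (by simp)) hd v
    rw [dir_coord] at h
    refine Eq.trans h ?_
    rw [show σ8 (θ8 x v) = -(θ8 x v 0) • qj by ext <;> simp [σ8], mul_smul_comm, ← cexp_comm]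
    simp
  smooth_coeff X hX := by
    simp only [← dir_coord]
    exact contMDiff_dir contMDiff_coord hX
  re_σ _ := rfl
  isImag _ := ⟨rfl, rfl⟩
  metric a b := by
    simp [frameMetric, ν8, inner_eq, dotProduct, Fin.sum_univ_three]; ring
  lagrangian a b := by
    simp [frameMetric, frameJ, ν8, inner_eq]; ring
  decomp := by
    rintro ⟨A, B⟩ ⟨hA, hB⟩
    dsimp only at hA hB
    refine ⟨![(A.imJ + B.imJ) / 2, A.imK / 2 - B.imK, A.imI - B.imI / 2],
      ![(A.imJ - B.imJ) / 2, -A.imK / 2, -B.imI / 2], ?_⟩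
    ext <;> simp [ν8, frameJ, hA, hB] <;> ring
  cov_tangent a b := by
    ext <;> simp [frameCov, ν8, σ8, frameJ, cross, symCross] <;> ring
  cov_normal a b := by
    ext <;> simp [frameCov, ν8, σ8, frameJ, cross, symCross] <;> ring

end NKS3S3

end

/-- The immersions `f₇` and `f₈` into the nearly Kähler `S³ × S³` are Lagrangian, not totally
geodesic, and `J`-isotropic with `λ = 0`, i.e. `J`-parallel. -/
theorem proposition5p1 :
    (NKS3S3.IsJParallel NKS3S3.f7 ∧ ¬ NKS3S3.IsTotallyGeodesic NKS3S3.f7) ∧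
      (NKS3S3.IsJParallel NKS3S3.f8 ∧ ¬ NKS3S3.IsTotallyGeodesic NKS3S3.f8) := by
  have h7 := NKS3S3.hasConstantFrame_f7
  have h8 := NKS3S3.hasConstantFrame_f8
  exact ⟨⟨h7.isJParallel (NKS3S3.contMDiff_of_pos h7.smooth_pos),
      h7.not_isTotallyGeodesic (by norm_num) (NKS3S3.exists_isSmoothField ⟨1, by simp⟩)⟩,
    ⟨h8.isJParallel (NKS3S3.contMDiff_of_pos h8.smooth_pos),
      h8.not_isTotallyGeodesic (by norm_num) (NKS3S3.exists_isSmoothField 0)⟩⟩
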